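/- **Setting.** Let $U,V$ be separable real Banach spaces and let $(\Omega,\mathcal A,P)$ be a probability space with a filtration $(\mathcal F_t)_{t\ge 0}$. A cylindrical process in $U$ is a family $W=(W(t))_{t\ge0}$ of linear maps $W(t):U^*\to L^0(\Omega)$. It is a strongly cylindrical Wiener process if it is adapted and the following two conditions hold. * For all $n$ and $u_1^*,\dots,u_n^*\in U^*$ the process $X(t)=(W(t)u_1^*,\dots,W(t)u_n^*)$ is an $\mathbb R^n$-valued Wiener process with respect to $(\mathcal F_t)$: it is adapted, $X(0)=0$ a.s., and for $s\le t$ the increment $X(t)-X(s)$ is independent of $\mathcal F_s$ and has law $N(0,(t-s)C)$ for some positive semidefinite matrix $C$ that does not depend on $s,t$. * The centred Gaussian random variables $W(1)u^*$ have a $U$-valued covariance operator $Q:U^*\to U$, that is, $\operatorname{Cov}(W(1)u^*,W(1)v^*)=\langle Qu^*,v^*\rangle$ for all $u^*,v^*\in U^*$. The operator $Q$ is bounded, positive and symmetric. Let $H$ be its reproducing kernel Hilbert space, that is, the completion of the range of $Q$ under $[Qu^*,Qv^*]=\langle Qu^*,v^*\rangle$. Let $i_Q:H\to U$ be the continuous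 extension of the inclusion and $i_Q^*:U^*\to H$ its adjoint. Let $(e_k)$ be a (finite or countable) orthonormal basis of $H$ with $e_k=i_Q^*u_k^*$ for some $u_k^*\in U^*$, and put $B_k(t)=W(t)u_k^*$. For $T\ge0$ let $M_T(U,V)$ be the set of all $\Phi:[0,T]\times\Omega\to L(U,V)$ such that for every $v^*\in V^*$: the map $(t,\omega)\mapsto\Phi^*(t,\omega)v^*\in U^*$ is $\mathcal B[0,T]\otimes\mathcal A$-measurable; $\Phi^*(t,\cdot)v^*$ is $\mathcal F_t$-measurable for each $t\in[0,T]$; and $\int_0^T E\|\Phi^*(s)v^*\|_{U^*}^2\,ds<\infty$. For $\Phi\in M_T(U,V)$, $v^*\in V^*$ and $t\in[0,T]$ the cylindrical stochastic integral is $$\Big(\int_0^t\Phi(s)\,dW(s)\Big)v^*:=\sum_k\int_0^t\langle\Phi(s)i_Qe_k,v^*\rangle\,dB_k(s)\quad\text{in }L^2(\Omega),$$ where the terms are real-valued Itô integrals ($L^2$-limits of elementary integrals of simple adapted processes). **Theorem.** Let $W$ be a strongly cylindrical Wiener process in $U$ with covariance operator $Q$, let $(e_k),(u_k^*)$ be as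 above, and let $\Phi\in M_T(U,V)$ and $v^*\in V^*$. Then the Itô integrals above exist and the series converges in $L^2(\Omega)$ for every $t\in[0,T]$, and: (a) the family $\big((\int_0^t\Phi(s)\,dW(s))v^*\big)_{t\in[0,T]}$ is a continuous square-integrable martingale, that is, it has a version that is a square-integrable $(\mathcal F_t)$-martingale on $[0,T]$ with almost surely continuous paths; (b) for every $t\in[0,T]$ Itô's isometry holds: $$E\Big|\Big(\int_0^t\Phi(s)\,dW(s)\Big)v^*\Big|^2=\int_0^tE\big\|i_Q^*\Phi^*(s)v^*\big\|_H^2\,ds .$$ -/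

import Mathlib

open MeasureTheory ProbabilityTheory Filter Topology
open scoped NNReal ENNReal

noncomputable section

/-! ### Reproducing kernel Hilbert space of a positive symmetric operator -/

/-- A bounded linear operator `Q : U* → U` that is positive and symmetric. -/
structure PosSymmOperator (U : Type*) [NormedAddCommGroup U] [NormedSpace ℝ U] where
  /-- the operator -/
  op : StrongDual ℝ U →L[ℝ] U
  nonneg : ∀ u : StrongDual ℝ U, 0 ≤ u (op u)
  symm : ∀ u v : StrongDual ℝ U, v (op u) = u (op v)

namespace PosSymmOperator

variable {U : Type*} [NormedAddCommGroup U] [NormedSpace ℝ U] (Q : PosSymmOperator U)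

/-- The range of `Q`. It is a type of its own since it carries the norm of the inner product
`[Qu*, Qv*] = ⟨Qu*, v*⟩` and not the norm of `U`. -/
def Range : Type _ := LinearMap.range (Q.op : StrongDual ℝ U →ₗ[ℝ] U)

instance : AddCommGroup Q.Range :=
  inferInstanceAs (AddCommGroup (LinearMap.range (Q.op : StrongDual ℝ U →ₗ[ℝ] U)))

instance : Module ℝ Q.Range :=
  inferInstanceAs (Module ℝ (LinearMap.range (Q.op : StrongDual ℝ U →ₗ[ℝ] U)))

/-- The inclusion of the range of `Q` into `U`, as a linear map. -/
def inclₗ : Q.Range →ₗ[ℝ] U := (LinearMap.range (Q.op : StrongDual ℝ U →ₗ[ℝ] U)).subtype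

/-- `Qu*` as an element of the range of `Q`. -/
def toRange : StrongDual ℝ U →ₗ[ℝ] Q.Range := (Q.op : StrongDual ℝ U →ₗ[ℝ] U).rangeRestrict

theorem inclₗ_injective : Function.Injective Q.inclₗ := Subtype.val_injective

@[simp] theorem inclₗ_toRange (u : StrongDual ℝ U) : Q.inclₗ (Q.toRange u) = Q.op u := rfl

theorem toRange_surjective : Function.Surjective Q.toRange :=
  LinearMap.surjective_rangeRestrict _

/-- The bilinear form `[Qu*, Qv*] = ⟨Qu*, v*⟩` on the range of `Q`. -/
def form (x y : Q.Range) : ℝ := (Q.toRange_surjective y).choose (Q.inclₗ x)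

/-- The value does not depend on the chosen preimage of the second argument. -/
theorem form_toRange (x : Q.Range) (v : StrongDual ℝ U) :
    Q.form x (Q.toRange v) = v (Q.inclₗ x) := by
  obtain ⟨u, rfl⟩ := Q.toRange_surjective x
  have h := (Q.toRange_surjective (Q.toRange v)).choose_spec
  have h' := congrArg Q.inclₗ h
  rw [inclₗ_toRange, inclₗ_toRange] at h'
  unfold form
  rw [inclₗ_toRange, Q.symm, h', Q.symm]

theorem form_toRange_toRange (u v : StrongDual ℝ U) :
    Q.form (Q.toRange u) (Q.toRange v) = v (Q.op u) := by
  rw [form_toRange, inclₗ_toRange]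

theorem form_symm (x y : Q.Range) : Q.form y x = Q.form x y := by
  obtain ⟨u, rfl⟩ := Q.toRange_surjective x
  obtain ⟨v, rfl⟩ := Q.toRange_surjective y
  rw [form_toRange_toRange, form_toRange_toRange, Q.symm]

theorem form_nonneg (x : Q.Range) : 0 ≤ Q.form x x := by
  obtain ⟨u, rfl⟩ := Q.toRange_surjective x
  rw [form_toRange_toRange]
  exact Q.nonneg u

theorem form_add (x y z : Q.Range) : Q.form (x + y) z = Q.form x z + Q.form y z := by
  simp [form]

theorem form_smul (x y : Q.Range) (r : ℝ) : Q.form (r • x) y = r * Q.form x y := by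
  simp [form]

/-- The form is positive definite. -/
theorem form_definite (x : Q.Range) (h : Q.form x x = 0) : x = 0 := by
  have key : ∀ y : Q.Range, Q.form x y = 0 := by
    intro y
    by_contra hne
    have expand : ∀ r : ℝ, 0 ≤ Q.form y y + 2 * r * Q.form x y := by
      intro r
      have h1 := Q.form_nonneg (r • x + y)
      rw [form_add, form_smul, Q.form_symm (r • x + y) x, Q.form_symm (r • x + y) y, form_add,
        form_add, form_smul, form_smul, h, Q.form_symm x y] at h1
      linarith
    have h2 := expand (-(Q.form y y + 1) / (2 * Q.form x y))
    have h3 : 2 * (-(Q.form y y + 1) / (2 * Q.form x y)) * Q.form x y = -(Q.form y y + 1) := by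
      field_simp
    rw [h3] at h2
    linarith
  apply Q.inclₗ_injective
  rw [map_zero]
  refine SeparatingDual.eq_zero_of_forall_dual_eq_zero (R := ℝ) fun v => ?_
  rw [← form_toRange]
  exact key _

/-- The inner product on the range of `Q`. -/
@[reducible] def core : InnerProductSpace.Core ℝ Q.Range where
  inner := Q.form
  conj_inner_symm x y := Q.form_symm x y
  re_inner_nonneg x := Q.form_nonneg x
  add_left := Q.form_add
  smul_left x y r := Q.form_smul x y r
  definite := Q.form_definite

instance : NormedAddCommGroup Q.Range := Q.core.toNormedAddCommGroup

instance : InnerProductSpace ℝ Q.Range := InnerProductSpace.ofCore Q.core.toCore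

theorem inner_toRange (x : Q.Range) (v : StrongDual ℝ U) :
    inner ℝ x (Q.toRange v) = v (Q.inclₗ x) := Q.form_toRange x v

/-- The inclusion of the range of `Q` into `U` is bounded. -/
theorem norm_inclₗ_le (x : Q.Range) : ‖Q.inclₗ x‖ ≤ √‖Q.op‖ * ‖x‖ := by
  refine NormedSpace.norm_le_dual_bound ℝ _ (by positivity) fun v => ?_
  rw [← inner_toRange]
  have h1 : ‖Q.toRange v‖ ≤ √‖Q.op‖ * ‖v‖ := by
    refine (sq_le_sq₀ (norm_nonneg _) (by positivity)).1 ?_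
    rw [mul_pow, Real.sq_sqrt (norm_nonneg Q.op)]
    rw [← real_inner_self_eq_norm_sq, inner_toRange, inclₗ_toRange]
    calc v (Q.op v) ≤ ‖v (Q.op v)‖ := Real.le_norm_self _
      _ ≤ ‖v‖ * ‖Q.op v‖ := v.le_opNorm _
      _ ≤ ‖v‖ * (‖Q.op‖ * ‖v‖) := by gcongr; exact Q.op.le_opNorm v
      _ = ‖Q.op‖ * ‖v‖ ^ 2 := by ring
  calc ‖inner ℝ x (Q.toRange v)‖ ≤ ‖x‖ * ‖Q.toRange v‖ := norm_inner_le_norm _ _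
    _ ≤ ‖x‖ * (√‖Q.op‖ * ‖v‖) := by gcongr
    _ = √‖Q.op‖ * ‖x‖ * ‖v‖ := by ring

/-- The inclusion of the range of `Q` into `U`, as a bounded operator. -/
def incl : Q.Range →L[ℝ] U := Q.inclₗ.mkContinuous (√‖Q.op‖) Q.norm_inclₗ_le

/-- The reproducing kernel Hilbert space `H_Q`: the completion of the range of `Q`. -/
abbrev RKHS : Type _ := UniformSpace.Completion Q.Range

/-- The bounded operator `i_Q : H_Q → U` that extends the inclusion of the range of `Q`. -/
def iQ [CompleteSpace U] : Q.RKHS →L[ℝ] U :=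
  Q.incl.extend (UniformSpace.Completion.toComplL (𝕜 := ℝ) (E := Q.Range))

@[simp] theorem iQ_coe [CompleteSpace U] (x : Q.Range) : Q.iQ (x : Q.RKHS) = Q.inclₗ x :=
  ContinuousLinearMap.extend_eq Q.incl UniformSpace.Completion.denseRange_coe
    (UniformSpace.Completion.isUniformInducing_coe _) x

/-- The adjoint `i_Q* : U* → H_Q`, where `H_Q` is identified with its dual: it maps `u*` to the
element that represents the functional `u* ∘ i_Q`. -/
def iQAdj [CompleteSpace U] (u : StrongDual ℝ U) : Q.RKHS :=
  (InnerProductSpace.toDual ℝ Q.RKHS).symm (u.comp Q.iQ)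

theorem inner_iQAdj [CompleteSpace U] (h : Q.RKHS) (u : StrongDual ℝ U) :
    inner ℝ h (Q.iQAdj u) = u (Q.iQ h) := by
  rw [real_inner_comm, iQAdj, InnerProductSpace.toDual_symm_apply]
  rfl

end PosSymmOperator

/-! ### Cylindrical processes and cylindrical Wiener processes -/

section Probability

variable {Ω : Type*} {mΩ : MeasurableSpace Ω}

/-- A cylindrical random variable in `U`: a linear map from `U*` to `L⁰(Ω)`, the space of
almost everywhere equality classes of real random variables. -/
abbrev CylRV (U : Type*) [NormedAddCommGroup U] [NormedSpace ℝ U] (P : Measure Ω) : Type _ :=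
  StrongDual ℝ U →ₗ[ℝ] (Ω →ₘ[P] ℝ)

/-- An `ℝⁿ`-valued Wiener process with respect to the filtration `F`. The random variables
`X t` are considered up to almost sure equality, so that `F t`-measurability means equality almost
surely to an `F t`-measurable function. The `n × n` matrix `C` is the covariance matrix. -/
structure IsWienerProcess {n : ℕ} (F : Filtration ℝ≥0 mΩ) (P : Measure Ω)
    (X : ℝ≥0 → Ω → EuclideanSpace ℝ (Fin n)) : Prop where
  adapted : ∀ t, AEStronglyMeasurable[F t] (X t) P
  zero : X 0 =ᵐ[P] 0
  indep : ∀ s t, s ≤ t →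
    Indep (MeasurableSpace.comap (fun ω => X t ω - X s ω) inferInstance) (F s) P
  gaussian : ∃ C : Matrix (Fin n) (Fin n) ℝ, C.PosSemidef ∧ ∀ s t, s ≤ t →
    P.map (fun ω => X t ω - X s ω) = multivariateGaussian 0 (((t : ℝ) - s) • C)

variable {U : Type*} [NormedAddCommGroup U] [NormedSpace ℝ U]

/-- A cylindrical process is adapted if every `W(t)u*` is `F t`-measurable. -/
def CylAdapted (F : Filtration ℝ≥0 mΩ) (P : Measure Ω) (W : ℝ≥0 → CylRV U P) : Prop :=
  ∀ t u, AEStronglyMeasurable[F t] (W t u) P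

/-- Weakly cylindrical Wiener processes: adapted cylindrical processes for which all
`(W(t)u₁*, …, W(t)uₙ*)` are Wiener processes. -/
structure IsWeaklyCylWiener (F : Filtration ℝ≥0 mΩ) (P : Measure Ω) (W : ℝ≥0 → CylRV U P) :
    Prop where
  adapted : CylAdapted F P W
  wiener : ∀ (n : ℕ) (u : Fin n → StrongDual ℝ U),
    IsWienerProcess F P (fun t ω => WithLp.toLp 2 fun i => W t (u i) ω)

/-- `Q` is the covariance operator of the cylindrical random variable `X`, and it is `U`-valued:
`Cov(Xu*, Xv*) = ⟨Qu*, v*⟩`. -/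
def HasCovarianceOperator (P : Measure Ω) (X : CylRV U P) (Q : StrongDual ℝ U → U) : Prop :=
  ∀ u v : StrongDual ℝ U, cov[X u, X v; P] = v (Q u)

/-- The distribution of `X` is a centred strongly Gaussian cylindrical measure. -/
structure IsStronglyGaussian (P : Measure Ω) (X : CylRV U P) : Prop where
  gaussian : ∀ u, IsGaussian (P.map (X u))
  centred : ∀ u, ∫ ω, X u ω ∂P = 0
  covariance : ∃ Q : StrongDual ℝ U → U, HasCovarianceOperator P X Q

/-- Strongly cylindrical Wiener processes. -/
structure IsStronglyCylWiener (F : Filtration ℝ≥0 mΩ) (P : Measure Ω) (W : ℝ≥0 → CylRV U P) :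
    Prop where
  weakly : IsWeaklyCylWiener F P W
  strongly : IsStronglyGaussian P (W 1)

/-! ### The real-valued Itô integral -/

/-- Lebesgue measure `ds` on `[0, ∞)`. -/
def lebesgueNN : Measure ℝ≥0 := Measure.comap ((↑) : ℝ≥0 → ℝ) volume

/-- Simple adapted processes `∑ⱼ ξⱼ 1_(lⱼ, rⱼ]` with `ξⱼ` bounded and `F lⱼ`-measurable. -/
structure SimpleAdapted (F : Filtration ℝ≥0 mΩ) where
  /-- the number of terms -/
  n : ℕ
  /-- left end points -/
  left : Fin n → ℝ≥0
  /-- right end points -/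
  right : Fin n → ℝ≥0
  left_le_right : ∀ j, left j ≤ right j
  /-- coefficients -/
  coeff : Fin n → Ω → ℝ
  measurable_coeff : ∀ j, Measurable[F (left j)] (coeff j)
  bounded_coeff : ∃ C : ℝ, ∀ j ω, |coeff j ω| ≤ C

/-- The value of a simple process at time `s`. -/
def SimpleAdapted.eval {F : Filtration ℝ≥0 mΩ} (φ : SimpleAdapted F) (s : ℝ≥0) (ω : Ω) : ℝ :=
  ∑ j, (Set.Ioc (φ.left j) (φ.right j)).indicator (fun _ => φ.coeff j ω) s

/-- The elementary stochastic integral over `[0, t]` of a simple process with respect to `B`. -/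
def SimpleAdapted.integral {F : Filtration ℝ≥0 mΩ} (φ : SimpleAdapted F) (B : ℝ≥0 → Ω → ℝ)
    (t : ℝ≥0) (ω : Ω) : ℝ :=
  ∑ j, φ.coeff j ω * (B (min (φ.right j) t) ω - B (min (φ.left j) t) ω)

/-- `I` is the Itô integral `∫₀ᵗ f dB`: the limit in `L²(Ω)` of the elementary integrals of
simple adapted processes that converge to `f` in `L²([0, t] × Ω)`. -/
def IsItoIntegral (F : Filtration ℝ≥0 mΩ) (P : Measure Ω) (B f : ℝ≥0 → Ω → ℝ) (t : ℝ≥0)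
    (I : Lp ℝ 2 P) : Prop :=
  ∃ φ : ℕ → SimpleAdapted F,
    Tendsto (fun n => ∫⁻ s in Set.Icc 0 t, ∫⁻ ω, ‖f s ω - (φ n).eval s ω‖ₑ ^ 2 ∂P ∂lebesgueNN)
      atTop (𝓝 0) ∧
    Tendsto (fun n => eLpNorm (fun ω => (φ n).integral B t ω - I ω) 2 P) atTop (𝓝 0)

open Classical in
/-- The Itô integral `∫₀ᵗ f dB` in `L²(Ω)` (zero if it does not exist). -/
def itoIntegral (F : Filtration ℝ≥0 mΩ) (P : Measure Ω) (B f : ℝ≥0 → Ω → ℝ) (t : ℝ≥0) :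
    Lp ℝ 2 P :=
  if h : ∃ I, IsItoIntegral F P B f t I then h.choose else 0

/-! ### The cylindrical integral -/

variable {V : Type*} [NormedAddCommGroup V] [NormedSpace ℝ V]

/-- The class `M_T(U, V)` of integrands. Only the values of `Φ` on `[0, T]` matter. The
functional `Φ*(t, ω)v* ∈ U*` is `v* ∘ Φ(t, ω)`, and `U*` carries the Borel σ-algebra of its norm. -/
structure MemM (F : Filtration ℝ≥0 mΩ) (P : Measure Ω) (T : ℝ≥0) (Φ : ℝ≥0 → Ω → U →L[ℝ] V) :
    Prop where
  measurable : ∀ v : StrongDual ℝ V,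
    Measurable fun p : Set.Icc 0 T × Ω => v.comp (Φ p.1 p.2)
  adapted : ∀ v : StrongDual ℝ V, ∀ t ≤ T, Measurable[F t] fun ω => v.comp (Φ t ω)
  sq_integrable : ∀ v : StrongDual ℝ V,
    ∫⁻ s in Set.Icc 0 T, ∫⁻ ω, ‖v.comp (Φ s ω)‖ₑ ^ 2 ∂P ∂lebesgueNN < ∞

/-- The `k`-th term `∫₀ᵗ ⟨Φ(s) i_Q e_k, v*⟩ dB_k(s)` of the series that defines the cylindrical
integral, where `B_k(s) = W(s)u_k*`. -/
def cylIntegralTerm [CompleteSpace U] (F : Filtration ℝ≥0 mΩ) (P : Measure Ω)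
    (W : ℝ≥0 → CylRV U P) (Q : PosSymmOperator U) {ι : Type*} (e : HilbertBasis ι ℝ Q.RKHS)
    (u : ι → StrongDual ℝ U) (Φ : ℝ≥0 → Ω → U →L[ℝ] V) (t : ℝ≥0) (v : StrongDual ℝ V) (k : ι) :
    Lp ℝ 2 P :=
  itoIntegral F P (fun s ω => W s (u k) ω) (fun s ω => v (Φ s ω (Q.iQ (e k)))) t

/-- The cylindrical integral
`(∫₀ᵗ Φ dW)v* = ∑ₖ ∫₀ᵗ ⟨Φ(s) i_Q e_k, v*⟩ dB_k(s)`, a series in `L²(Ω)`. -/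
def cylIntegral [CompleteSpace U] (F : Filtration ℝ≥0 mΩ) (P : Measure Ω)
    (W : ℝ≥0 → CylRV U P) (Q : PosSymmOperator U) {ι : Type*} (e : HilbertBasis ι ℝ Q.RKHS)
    (u : ι → StrongDual ℝ U) (Φ : ℝ≥0 → Ω → U →L[ℝ] V) (t : ℝ≥0) (v : StrongDual ℝ V) :
    Lp ℝ 2 P :=
  ∑' k, cylIntegralTerm F P W Q e u Φ t v k

/-! ### Continuous square-integrable martingales on `[0, T]` -/

/-- The restriction of a filtration to the time interval `[0, T]`. -/
def Filtration.upTo (F : Filtration ℝ≥0 mΩ) (T : ℝ≥0) : Filtration (Set.Icc 0 T) mΩ where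
  seq t := F t
  mono' _ _ h := F.mono h
  le' t := F.le t

/-- `M` is a square-integrable martingale on `[0, T]` with almost surely continuous paths. -/
structure IsContSqMartingale (F : Filtration ℝ≥0 mΩ) (P : Measure Ω) (T : ℝ≥0)
    (M : Set.Icc 0 T → Ω → ℝ) : Prop where
  martingale : Martingale M (Filtration.upTo F T) P
  sq_integrable : ∀ t, MemLp (M t) 2 P
  continuous : ∀ᵐ ω ∂P, Continuous fun t => M t ω

end Probability

end

noncomputable section

/-! ### Lebesgue measure on `[0, ∞)` -/

/-! The factorization `Q = i_Q i_Q*` gives `Cov(W(1)u*, W(1)w*) = [i_Q*u*, i_Q*w*]`. Since `e_k =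
i_Q*u_k*` is orthonormal, the `B_k` are standard Brownian motions whose mixed increments are
uncorrelated given the past. The Itô isometry is proved for two integrators at once, `E(∫f dB ∫g
dB') = c ∫E(fg) ds` with `c` the covariation rate (`IsItoIntegral.inner_eq`). With `c = 0` it makes
the terms of the series pairwise orthogonal; with `c = 1` it gives their norms. Parseval's identity
in `H` sums the squared norms to `∫E‖i_Q*Φ*v*‖²`, which is finite because `i_Q*` is bounded.
Convergence and the isometry follow.

The Itô integrals exist because simple processes are dense among the adapted ones
(`exists_tendsto_simpleAdapted`). This is a Hilbert space argument that needs only joint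
measurability and adaptedness at each time. Let `g` be the component of `f` orthogonal to the simple
processes. The integral of `g` over `(r, b]` is then orthogonal to everything `F r`-measurable, so
the process of these tail integrals is orthogonal to `f` and to all simple processes, hence to `g`.
But that pairing equals half of `E(∫₀ᵇ g)²`, so `g = 0`.

Conditional expectation is continuous on `L²`, so the martingale property passes from elementary
integrals to Itô integrals and to the series. For continuity of paths, fourth moments and a dyadic
chaining argument give each `B_k` a continuous modification, so elementary integrals have continuous
versions. The set of `x` in `L²` for which `E[x | F t]` has a continuous version is closed, by
Doob's maximal inequality and Borel–Cantelli (`isClosed_continuousVersionSet`), and it is stable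
under sums; hence it contains the value of the series at `T`. -/

theorem measurableEmbedding_coe_nnreal : MeasurableEmbedding ((↑) : ℝ≥0 → ℝ) :=
  MeasurableEmbedding.subtype_coe measurableSet_Ici

theorem lebesgueNN_Ioc (a b : ℝ≥0) : lebesgueNN (Set.Ioc a b) = ENNReal.ofReal (b - a) := by
  rw [lebesgueNN, measurableEmbedding_coe_nnreal.comap_apply, ← Real.volume_Ioc]
  congr 1
  ext x
  constructor
  · rintro ⟨y, hy, rfl⟩
    exact ⟨NNReal.coe_lt_coe.2 hy.1, NNReal.coe_le_coe.2 hy.2⟩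
  · intro hx
    have h0 : 0 ≤ x := a.2.trans hx.1.le
    exact ⟨⟨x, h0⟩, ⟨by exact_mod_cast hx.1, by exact_mod_cast hx.2⟩, rfl⟩

instance : NullSingletonClass lebesgueNN where
  measure_singleton x := by
    rw [lebesgueNN, measurableEmbedding_coe_nnreal.comap_apply]
    simp

theorem lebesgueNN_Icc (a b : ℝ≥0) : lebesgueNN (Set.Icc a b) = ENNReal.ofReal (b - a) := by
  rw [← lebesgueNN_Ioc, measure_congr Ioc_ae_eq_Icc]

instance (t : ℝ≥0) : IsFiniteMeasure (lebesgueNN.restrict (Set.Icc 0 t)) :=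
  ⟨by rw [Measure.restrict_apply_univ, lebesgueNN_Icc]; exact ENNReal.ofReal_lt_top⟩

section Wiener

variable {Ω : Type*} {mΩ : MeasurableSpace Ω}

/-! ### Square-integrable processes with orthogonal increments -/

/-- A square-integrable process, adapted up to null sets, whose increments after time `s` are
orthogonal to the square-integrable `F s`-measurable random variables. -/
structure HasOrthogonalIncrements (F : Filtration ℝ≥0 mΩ) (P : Measure Ω) (B : ℝ≥0 → Ω → ℝ) :
    Prop where
  memLp : ∀ t, MemLp (B t) 2 P
  adapted : ∀ t, AEStronglyMeasurable[F t] (B t) P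
  orthogonal : ∀ s t, s ≤ t → ∀ Z : Ω → ℝ, AEStronglyMeasurable[F s] Z P →
    ∫ ω, Z ω * (B t ω - B s ω) ∂P = 0

/-- The products of the increments of `B` and `B'` have conditional expectation `c (t - s)`. -/
def HasCovariation (F : Filtration ℝ≥0 mΩ) (P : Measure Ω) (c : ℝ) (B B' : ℝ≥0 → Ω → ℝ) : Prop :=
  ∀ s t, s ≤ t → ∀ Z : Ω → ℝ, AEStronglyMeasurable[F s] Z P →
    ∫ ω, Z ω * ((B t ω - B s ω) * (B' t ω - B' s ω)) ∂P = c * (t - s) * ∫ ω, Z ω ∂P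

/-! ### Independence and moments of Wiener increments -/

namespace IsWienerProcess

variable {F : Filtration ℝ≥0 mΩ} {P : Measure Ω} {n : ℕ} {X : ℝ≥0 → Ω → EuclideanSpace ℝ (Fin n)}

theorem aemeasurable_increment (hX : IsWienerProcess F P X) (s t : ℝ≥0) :
    AEMeasurable (fun ω => X t ω - X s ω) P :=
  (((hX.adapted t).mono (F.le t)).sub ((hX.adapted s).mono (F.le s))).aemeasurable

/-- No integrability is required: for independent factors the product formula also holds when a
factor is not integrable, with the convention that its integral is 0. Hence `Z` may be any `F
s`-measurable variable. -/
theorem integral_mul_increment (hX : IsWienerProcess F P X) {s t : ℝ≥0} (hst : s ≤ t)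
    {Z : Ω → ℝ} (hZ : AEStronglyMeasurable[F s] Z P) {g : EuclideanSpace ℝ (Fin n) → ℝ}
    (hg : Measurable g) :
    ∫ ω, Z ω * g (X t ω - X s ω) ∂P = (∫ ω, Z ω ∂P) * ∫ ω, g (X t ω - X s ω) ∂P := by
  have hZ' : StronglyMeasurable[F s] (hZ.mk Z) := hZ.stronglyMeasurable_mk
  have e1 : ∫ ω, Z ω * g (X t ω - X s ω) ∂P = ∫ ω, hZ.mk Z ω * g (X t ω - X s ω) ∂P := by
    refine integral_congr_ae ?_
    filter_upwards [hZ.ae_eq_mk] with ω hω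
    rw [← hω]
  have hind : IndepFun (hZ.mk Z) (fun ω => g (X t ω - X s ω)) P := by
    rw [IndepFun_iff_Indep]
    refine indep_of_indep_of_le_left (m₁ := F s) ?_ hZ'.measurable.comap_le
    refine indep_of_indep_of_le_right (hX.indep s t hst).symm ?_
    rintro _ ⟨A, hA, rfl⟩
    exact ⟨g ⁻¹' A, hg hA, rfl⟩
  have := hind.integral_mul_eq_mul_integral (hZ'.mono (F.le s)).aestronglyMeasurable
    (hg.comp_aemeasurable (hX.aemeasurable_increment s t)).aestronglyMeasurable
  rw [e1, integral_congr_ae hZ.ae_eq_mk]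
  exact this

theorem posSemidef_smul {C : Matrix (Fin n) (Fin n) ℝ} (hC : C.PosSemidef) {s t : ℝ≥0}
    (hst : s ≤ t) : (((t : ℝ) - s) • C).PosSemidef :=
  hC.smul (sub_nonneg.2 (NNReal.coe_le_coe.2 hst))

/-- The coordinates of the increments are centred Gaussian random variables. -/
theorem exists_map_increment (hX : IsWienerProcess F P X) (i : Fin n) :
    ∃ c : ℝ, 0 ≤ c ∧ ∀ s t, s ≤ t →
      P.map (fun ω => X t ω i - X s ω i) = gaussianReal 0 (((t : ℝ) - s) * c).toNNReal := by
  obtain ⟨C, hC, h⟩ := hX.gaussian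
  refine ⟨C i i, hC.diag_nonneg, fun s t hst => ?_⟩
  have := (measurePreserving_eval_multivariateGaussian (μ := 0)
    (posSemidef_smul hC hst) (i := i)).map_eq
  rw [← h s t hst, AEMeasurable.map_map_of_aemeasurable (by fun_prop)
    (hX.aemeasurable_increment s t)] at this
  exact this

theorem memLp_increment (hX : IsWienerProcess F P X) (i : Fin n) {s t : ℝ≥0} (hst : s ≤ t)
    (p : ℝ≥0) : MemLp (fun ω => X t ω i - X s ω i) p P := by
  obtain ⟨c, -, h⟩ := hX.exists_map_increment i
  have hm : AEMeasurable (fun ω => X t ω i - X s ω i) P :=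
    Measurable.comp_aemeasurable (g := fun x : EuclideanSpace ℝ (Fin n) => x i) (by fun_prop)
      (hX.aemeasurable_increment s t)
  have := memLp_id_gaussianReal (μ := 0) (v := (((t : ℝ) - s) * c).toNNReal) p
  rw [← h s t hst, memLp_map_measure_iff aestronglyMeasurable_id hm] at this
  exact this

theorem integral_increment (hX : IsWienerProcess F P X) (i : Fin n) {s t : ℝ≥0} (hst : s ≤ t) :
    ∫ ω, (X t ω i - X s ω i) ∂P = 0 := by
  obtain ⟨c, -, h⟩ := hX.exists_map_increment i
  have hm : AEMeasurable (fun ω => X t ω i - X s ω i) P :=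
    Measurable.comp_aemeasurable (g := fun x : EuclideanSpace ℝ (Fin n) => x i) (by fun_prop)
      (hX.aemeasurable_increment s t)
  rw [← integral_map (f := fun x : ℝ => x) hm aestronglyMeasurable_id, h s t hst,
    integral_id_gaussianReal]

theorem memLp_apply (hX : IsWienerProcess F P X) (i : Fin n) (t : ℝ≥0) (p : ℝ≥0) :
    MemLp (fun ω => X t ω i) p P := by
  refine (memLp_congr_ae ?_).1 (hX.memLp_increment i (zero_le (a := t)) p)
  filter_upwards [hX.zero] with ω hω
  simp [hω]

theorem hasOrthogonalIncrements (hX : IsWienerProcess F P X) (i : Fin n) :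
    HasOrthogonalIncrements F P (fun t ω => X t ω i) where
  memLp t := hX.memLp_apply i t 2
  adapted t := (show Continuous fun x : EuclideanSpace ℝ (Fin n) => x i by
    fun_prop).comp_aestronglyMeasurable (hX.adapted t)
  orthogonal s t hst Z hZ := by
    have := hX.integral_mul_increment hst hZ (g := fun x => x i) (by fun_prop)
    simp only [PiLp.sub_apply] at this
    rw [this, hX.integral_increment i hst, mul_zero]

/-- The covariation of two coordinates is the covariance of their values at time `1`. -/
theorem hasCovariation [IsProbabilityMeasure P] (hX : IsWienerProcess F P X) (i j : Fin n) :
    HasCovariation F P cov[fun ω => X 1 ω i, fun ω => X 1 ω j; P] (fun t ω => X t ω i)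
      (fun t ω => X t ω j) := by
  obtain ⟨C, hC, h⟩ := hX.gaussian
  have key : ∀ s t, s ≤ t → ∫ ω, (X t ω i - X s ω i) * (X t ω j - X s ω j) ∂P =
      ((t : ℝ) - s) * C i j := by
    intro s t hst
    have h1 := covariance_eval_multivariateGaussian (μ := 0) (posSemidef_smul hC hst) i j
    rw [← h s t hst, covariance_map (by fun_prop) (by fun_prop)
      (hX.aemeasurable_increment s t), covariance_eq_sub] at h1
    · simp only [Function.comp_def, Pi.mul_apply, PiLp.sub_apply] at h1
      rw [hX.integral_increment i hst, zero_mul, sub_zero] at h1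
      rw [h1]; simp
    · exact hX.memLp_increment i hst 2
    · exact hX.memLp_increment j hst 2
  -- Since `X 0 = 0` almost surely, the value at time 1 is the increment over `[0, 1]`.
  have hc : cov[fun ω => X 1 ω i, fun ω => X 1 ω j; P] = C i j := by
    have h0 : ∀ k : Fin n, (fun ω => X 1 ω k) =ᵐ[P] fun ω => X 1 ω k - X 0 ω k := by
      intro k
      filter_upwards [hX.zero] with ω hω
      simp [hω]
    rw [covariance_eq_sub (hX.memLp_apply i 1 2) (hX.memLp_apply j 1 2), integral_congr_ae (h0 i),
      integral_congr_ae ((h0 i).mul (h0 j)), hX.integral_increment i zero_le_one, zero_mul,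
      sub_zero]
    have := key 0 1 zero_le_one
    simpa using this
  intro s t hst Z hZ
  have := hX.integral_mul_increment hst hZ (g := fun x => x i * x j) (by fun_prop)
  simp only [PiLp.sub_apply] at this
  rw [this, key s t hst, hc]
  ring

/-- The fourth moments of the increments are of order `(t - s)²`. -/
theorem exists_lintegral_increment_pow_four (hX : IsWienerProcess F P X) (i : Fin n) :
    ∃ K : ℝ≥0, ∀ s t, s ≤ t →
      ∫⁻ ω, ‖X t ω i - X s ω i‖ₑ ^ 4 ∂P = K * ENNReal.ofReal (t - s) ^ 2 := by
  obtain ⟨c, hc, h⟩ := hX.exists_map_increment i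
  have hfin : ∫⁻ x, ‖x‖ₑ ^ 4 ∂(gaussianReal 0 1) < ∞ := by
    have := (memLp_id_gaussianReal (μ := 0) (v := 1) 4).2
    have h4 := lintegral_rpow_enorm_lt_top_of_eLpNorm_lt_top (p := (4 : ℝ≥0)) (by simp) (by simp)
      this
    simpa using h4
  lift ∫⁻ x, ‖x‖ₑ ^ 4 ∂(gaussianReal 0 1) to ℝ≥0 using hfin.ne with m hm
  refine ⟨m * (c ^ 2).toNNReal, fun s t hst => ?_⟩
  have hm' : AEMeasurable (fun ω => X t ω i - X s ω i) P :=
    Measurable.comp_aemeasurable (g := fun x : EuclideanSpace ℝ (Fin n) => x i) (by fun_prop)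
      (hX.aemeasurable_increment s t)
  have hts : 0 ≤ (t : ℝ) - s := sub_nonneg.2 (NNReal.coe_le_coe.2 hst)
  rw [← lintegral_map' (f := fun x : ℝ => ‖x‖ₑ ^ 4) (by fun_prop) hm', h s t hst]
  -- Gaussian scaling: the increment is distributed as `√((t - s)c)` times a standard normal
  -- variable, so its fourth moment is `((t - s)c)²` times the standard one.
  have hv : gaussianReal 0 (((t : ℝ) - s) * c).toNNReal =
      (gaussianReal 0 1).map (fun x => √((t - s) * c) * x) := by
    rw [gaussianReal_map_const_mul, mul_zero]
    congr 1
    ext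
    simp [Real.sq_sqrt (mul_nonneg hts hc), mul_nonneg hts hc]
  rw [hv, lintegral_map (by fun_prop) (by fun_prop)]
  simp_rw [enorm_mul, mul_pow]
  rw [lintegral_const_mul _ (by fun_prop), ← hm]
  have e : ‖√((t - s) * c)‖ₑ ^ 4 = ENNReal.ofReal (c ^ 2) * ENNReal.ofReal (t - s) ^ 2 := by
    rw [Real.enorm_eq_ofReal (Real.sqrt_nonneg _), ← ENNReal.ofReal_pow (Real.sqrt_nonneg _),
      ← ENNReal.ofReal_pow hts, ← ENNReal.ofReal_mul (by positivity)]
    congr 1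
    rw [show (4 : ℕ) = 2 * 2 from rfl, pow_mul, Real.sq_sqrt (mul_nonneg hts hc)]
    ring
  rw [e, ENNReal.coe_mul, ENNReal.ofReal]
  ring

end IsWienerProcess

end Wiener

section Simple

variable {Ω : Type*} {mΩ : MeasurableSpace Ω} {F : Filtration ℝ≥0 mΩ} {P : Measure Ω}

/-! ### Elementary stochastic integrals -/

/-- The measure `ds ⊗ P` on `[0, t] × Ω`. -/
abbrev timeProd (P : Measure Ω) (t : ℝ≥0) : Measure (ℝ≥0 × Ω) :=
  (lebesgueNN.restrict (Set.Icc 0 t)).prod P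

theorem HasCovariation.symm {c : ℝ} {B B' : ℝ≥0 → Ω → ℝ} (h : HasCovariation F P c B B') :
    HasCovariation F P c B' B := by
  intro s t hst Z hZ
  rw [← h s t hst Z hZ]
  exact integral_congr_ae (.of_forall fun ω => by simp only; ring)

theorem aestronglyMeasurable_sum_of_le {m : MeasurableSpace Ω} {κ : Type*} {f : κ → Ω → ℝ}
    (s : Finset κ) (hf : ∀ j, AEStronglyMeasurable[m] (f j) P) :
    AEStronglyMeasurable[m] (fun ω => ∑ j ∈ s, f j ω) P := by
  classical
  induction s using Finset.induction_on with
  | empty => simpa using! aestronglyMeasurable_const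
  | insert a s ha ih => simpa only [Finset.sum_insert ha] using! (hf a).add ih

theorem memLp_bdd_mul {Z f : Ω → ℝ} {C : ℝ} (hZ : AEStronglyMeasurable Z P)
    (hC : ∀ ω, |Z ω| ≤ C) (hf : MemLp f 2 P) : MemLp (fun ω => Z ω * f ω) 2 P := by
  refine MemLp.of_le_mul (c := C) hf (hZ.mul hf.1) (.of_forall fun ω => ?_)
  rw [norm_mul]
  exact mul_le_mul_of_nonneg_right (hC ω) (norm_nonneg _)

/-! ### Products of increments of two integrators -/

namespace HasOrthogonalIncrements

variable {B B' : ℝ≥0 → Ω → ℝ} {c : ℝ}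

theorem memLp_sub (hB : HasOrthogonalIncrements F P B) (s t : ℝ≥0) :
    MemLp (fun ω => B t ω - B s ω) 2 P := (hB.memLp t).sub (hB.memLp s)

theorem adapted_sub (hB : HasOrthogonalIncrements F P B) {s t r : ℝ≥0} (hs : s ≤ r) (ht : t ≤ r) :
    AEStronglyMeasurable[F r] (fun ω => B t ω - B s ω) P :=
  ((hB.adapted t).mono (F.mono ht)).sub ((hB.adapted s).mono (F.mono hs))

/-- Split the longer increment of `B'` at `a`. The part after `a` is orthogonal to the `F
a`-measurable factor `Z (B a - B s)`; the part up to `a` is covered by the covariation. -/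
theorem integral_mul_sub_mul_sub_of_le (hB : HasOrthogonalIncrements F P B)
    (hB' : HasOrthogonalIncrements F P B') (hc : HasCovariation F P c B B') {s a b : ℝ≥0}
    (ha : s ≤ a) (hab : a ≤ b) {Z : Ω → ℝ} {C : ℝ} (hZ : AEStronglyMeasurable[F s] Z P)
    (hC : ∀ ω, |Z ω| ≤ C) :
    ∫ ω, Z ω * ((B a ω - B s ω) * (B' b ω - B' s ω)) ∂P = c * (a - s) * ∫ ω, Z ω ∂P := by
  have hZa : MemLp (fun ω => Z ω * (B a ω - B s ω)) 2 P :=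
    memLp_bdd_mul (hZ.mono (F.le s)) hC (hB.memLp_sub s a)
  have h0 := hB'.orthogonal a b hab (fun ω => Z ω * (B a ω - B s ω))
    ((hZ.mono (F.mono ha)).mul (hB.adapted_sub ha le_rfl))
  have h1 := integral_add (hZa.integrable_mul (hB'.memLp_sub s a))
    (hZa.integrable_mul (hB'.memLp_sub a b))
  simp only [Pi.mul_apply] at h1
  rw [h0, add_zero] at h1
  simp_rw [mul_assoc] at h1
  rw [← hc s a ha Z hZ, ← h1]
  exact integral_congr_ae (.of_forall fun ω => by simp only; ring)

theorem integral_mul_sub_mul_sub (hB : HasOrthogonalIncrements F P B)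
    (hB' : HasOrthogonalIncrements F P B') (hc : HasCovariation F P c B B') {s a b : ℝ≥0}
    (ha : s ≤ a) (hb : s ≤ b) {Z : Ω → ℝ} {C : ℝ} (hZ : AEStronglyMeasurable[F s] Z P)
    (hC : ∀ ω, |Z ω| ≤ C) :
    ∫ ω, Z ω * ((B a ω - B s ω) * (B' b ω - B' s ω)) ∂P =
      c * ((min a b : ℝ≥0) - s) * ∫ ω, Z ω ∂P := by
  rcases le_total a b with hab | hab
  · rw [min_eq_left hab, hB.integral_mul_sub_mul_sub_of_le hB' hc ha hab hZ hC]
  · rw [min_eq_right hab, ← hB'.integral_mul_sub_mul_sub_of_le hB hc.symm hb hab hZ hC]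
    exact integral_congr_ae (.of_forall fun ω => by simp only; ring)

/-- Cut the increment of `B` at the later left end point `l'`. What precedes `l'` is `F
l'`-measurable and is annihilated by the increment of `B'`, so only the overlap of the two intervals
contributes. -/
theorem integral_term_mul_term_of_le (hB : HasOrthogonalIncrements F P B)
    (hB' : HasOrthogonalIncrements F P B') (hc : HasCovariation F P c B B')
    {l r l' r' : ℝ≥0} (hlr' : l' ≤ r') (hll : l ≤ l') {ξ ξ' : Ω → ℝ}
    {C C' : ℝ} (hξ : Measurable[F l] ξ) (hξ' : Measurable[F l'] ξ') (hC : ∀ ω, |ξ ω| ≤ C)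
    (hC' : ∀ ω, |ξ' ω| ≤ C') :
    ∫ ω, (ξ ω * (B r ω - B l ω)) * (ξ' ω * (B' r' ω - B' l' ω)) ∂P =
      c * max 0 ((min r r' : ℝ≥0) - (l' : ℝ)) * ∫ ω, ξ ω * ξ' ω ∂P := by
  have hξl : StronglyMeasurable[F l'] ξ := (hξ.mono (F.mono hll) le_rfl).stronglyMeasurable
  have hm : AEStronglyMeasurable[F l'] (fun ω => ξ ω * ξ' ω) P :=
    (hξl.mul hξ'.stronglyMeasurable).aestronglyMeasurable
  have hb : ∀ ω, |ξ ω * ξ' ω| ≤ C * C' := fun ω => by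
    rw [abs_mul]
    exact mul_le_mul (hC ω) (hC' ω) (abs_nonneg _) ((abs_nonneg _).trans (hC ω))
  -- The end points `max r l'` and, below, `min r l'` treat both orders of `r` and `l'` together: if
  -- `r ≤ l'`, the increment after `l'` is zero.
  have h1 := hB.integral_mul_sub_mul_sub hB' hc (s := l') (a := max r l') (b := r')
    (le_max_right _ _) hlr' hm hb
  have h2 := hB'.orthogonal l' r' hlr' (fun ω => (ξ ω * ξ' ω) * (B (min r l') ω - B l ω))
    (hm.mul (hB.adapted_sub hll (min_le_right _ _)))
  have e : (max 0 ((min r r' : ℝ≥0) - (l' : ℝ)) : ℝ) = (min (max r l') r' : ℝ≥0) - (l' : ℝ) := by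
    rcases le_total r l' with h | h
    · rw [max_eq_right h, min_eq_left hlr', sub_self]
      refine max_eq_left (sub_nonpos.2 (NNReal.coe_le_coe.2 ((min_le_left _ _).trans h)))
    · rw [max_eq_left h]
      exact max_eq_right (sub_nonneg.2 (NNReal.coe_le_coe.2 (le_min h hlr')))
  have h3 := integral_add ((memLp_bdd_mul (hm.mono (F.le _)) hb
      (hB.memLp_sub l' (max r l'))).integrable_mul (hB'.memLp_sub l' r'))
    ((memLp_bdd_mul (hm.mono (F.le _)) hb (hB.memLp_sub l (min r l'))).integrable_mul
      (hB'.memLp_sub l' r'))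
  simp only [Pi.mul_apply] at h3
  rw [h2, add_zero] at h3
  simp_rw [mul_assoc (_ * _) (_ - _) (_ - _)] at h3
  rw [e, ← h1, ← h3]
  refine integral_congr_ae (.of_forall fun ω => ?_)
  simp only
  rcases le_total r l' with h | h
  · rw [max_eq_right h, min_eq_left h]; ring
  · rw [max_eq_left h, min_eq_right h]; ring

theorem integral_term_mul_term (hB : HasOrthogonalIncrements F P B)
    (hB' : HasOrthogonalIncrements F P B') (hc : HasCovariation F P c B B')
    {l r l' r' : ℝ≥0} (hlr : l ≤ r) (hlr' : l' ≤ r') {ξ ξ' : Ω → ℝ}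
    {C C' : ℝ} (hξ : Measurable[F l] ξ) (hξ' : Measurable[F l'] ξ') (hC : ∀ ω, |ξ ω| ≤ C)
    (hC' : ∀ ω, |ξ' ω| ≤ C') :
    ∫ ω, (ξ ω * (B r ω - B l ω)) * (ξ' ω * (B' r' ω - B' l' ω)) ∂P =
      c * lebesgueNN.real (Set.Ioc l r ∩ Set.Ioc l' r') * ∫ ω, ξ ω * ξ' ω ∂P := by
  rw [Set.Ioc_inter_Ioc, measureReal_def, lebesgueNN_Ioc, ENNReal.toReal_ofReal',
    max_comm _ (0 : ℝ)]
  rcases le_total l l' with h | h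
  · rw [sup_eq_right.2 h]
    exact hB.integral_term_mul_term_of_le hB' hc hlr' h hξ hξ' hC hC'
  · rw [sup_eq_left.2 h, inf_comm]
    simp_rw [mul_comm (ξ _) (ξ' _)]
    rw [← hB'.integral_term_mul_term_of_le hB hc.symm hlr h hξ' hξ hC' hC]
    exact integral_congr_ae (.of_forall fun ω => by simp only; ring)

/-- Stopping at `t` truncates the intervals, which amounts to restricting the time measure to `[0,
t]`. An interval that starts after `t` has both stopped end points equal to `t`. -/
theorem integral_stopped_term_mul_stopped_term (hB : HasOrthogonalIncrements F P B)
    (hB' : HasOrthogonalIncrements F P B') (hc : HasCovariation F P c B B')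
    {l r l' r' : ℝ≥0} (hlr : l ≤ r) (hlr' : l' ≤ r') {ξ ξ' : Ω → ℝ}
    {C C' : ℝ} (hξ : Measurable[F l] ξ) (hξ' : Measurable[F l'] ξ') (hC : ∀ ω, |ξ ω| ≤ C)
    (hC' : ∀ ω, |ξ' ω| ≤ C') (t : ℝ≥0) :
    ∫ ω, (ξ ω * (B (min r t) ω - B (min l t) ω)) * (ξ' ω * (B' (min r' t) ω - B' (min l' t) ω)) ∂P =
      c * (lebesgueNN.restrict (Set.Icc 0 t)).real (Set.Ioc l r ∩ Set.Ioc l' r') *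
        ∫ ω, ξ ω * ξ' ω ∂P := by
  rw [measureReal_restrict_apply (measurableSet_Ioc.inter measurableSet_Ioc)]
  rcases le_total l t with hl | hl
  · rcases le_total l' t with hl' | hl'
    · rw [min_eq_left hl, min_eq_left hl', hB.integral_term_mul_term hB' hc (le_min hlr hl)
        (le_min hlr' hl') hξ hξ' hC hC']
      have : Set.Ioc l (min r t) ∩ Set.Ioc l' (min r' t) =
          Set.Ioc l r ∩ Set.Ioc l' r' ∩ Set.Icc 0 t := by
        ext x
        simp only [Set.mem_inter_iff, Set.mem_Ioc, Set.mem_Icc, le_min_iff, zero_le, true_and]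
        tauto
      rw [this]
    · have : Set.Ioc l r ∩ Set.Ioc l' r' ∩ Set.Icc 0 t = ∅ := by
        ext x
        simp only [Set.mem_inter_iff, Set.mem_Ioc, Set.mem_Icc, Set.mem_empty_iff_false, iff_false]
        exact fun h => (hl'.trans_lt h.1.2.1).not_ge h.2.2
      simp [this, min_eq_right hl', min_eq_right (hl'.trans hlr')]
  · have : Set.Ioc l r ∩ Set.Ioc l' r' ∩ Set.Icc 0 t = ∅ := by
      ext x
      simp only [Set.mem_inter_iff, Set.mem_Ioc, Set.mem_Icc, Set.mem_empty_iff_false, iff_false]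
      exact fun h => (hl.trans_lt h.1.1.1).not_ge h.2.2
    simp [this, min_eq_right hl, min_eq_right (hl.trans hlr)]

end HasOrthogonalIncrements

/-! ### Isometry and martingale property of elementary integrals -/

namespace SimpleAdapted

variable {B B' : ℝ≥0 → Ω → ℝ} {c : ℝ}

theorem memLp_integral (hB : HasOrthogonalIncrements F P B) (φ : SimpleAdapted F) (t : ℝ≥0) :
    MemLp (φ.integral B t) 2 P := by
  obtain ⟨C, hC⟩ := φ.bounded_coeff
  exact memLp_finsetSum Finset.univ fun j _ => memLp_bdd_mul
    ((φ.measurable_coeff j).mono (F.le _) le_rfl).aestronglyMeasurable (hC j) (hB.memLp_sub _ _)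

theorem eval_eq (φ : SimpleAdapted F) (s : ℝ≥0) (ω : Ω) :
    φ.eval s ω =
      ∑ j, (Set.Ioc (φ.left j) (φ.right j)).indicator (fun _ => (1 : ℝ)) s * φ.coeff j ω := by
  refine Finset.sum_congr rfl fun j _ => ?_
  simp [Set.indicator_apply]

theorem measurable_eval (φ : SimpleAdapted F) :
    Measurable fun p : ℝ≥0 × Ω => φ.eval p.1 p.2 := by
  simp_rw [eval_eq]
  refine Finset.measurable_sum _ fun j _ => Measurable.mul ?_ ?_
  · exact (measurable_const.indicator measurableSet_Ioc).comp measurable_fst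
  · exact ((φ.measurable_coeff j).mono (F.le _) le_rfl).comp measurable_snd

theorem stronglyMeasurable_eval (φ : SimpleAdapted F) (s : ℝ≥0) :
    StronglyMeasurable[F s] (φ.eval s) := by
  refine Measurable.stronglyMeasurable (f := φ.eval s) ?_
  refine Finset.measurable_sum (m := F s) _ fun j _ => ?_
  by_cases h : s ∈ Set.Ioc (φ.left j) (φ.right j)
  · simp only [Set.indicator_of_mem h]
    exact (φ.measurable_coeff j).mono (F.mono h.1.le) le_rfl
  · simp only [Set.indicator_of_notMem h]
    exact measurable_const

theorem exists_abs_eval_le (φ : SimpleAdapted F) : ∃ C : ℝ, ∀ s ω, |φ.eval s ω| ≤ C := by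
  obtain ⟨C, hC⟩ := φ.bounded_coeff
  refine ⟨∑ _j : Fin φ.n, C, fun s ω => (Finset.abs_sum_le_sum_abs _ _).trans ?_⟩
  refine Finset.sum_le_sum fun j _ => ?_
  by_cases h : s ∈ Set.Ioc (φ.left j) (φ.right j)
  · simpa only [Set.indicator_of_mem h] using hC j ω
  · simpa only [Set.indicator_of_notMem h, abs_zero] using (abs_nonneg _).trans (hC j ω)

theorem aestronglyMeasurable_integral (hB : HasOrthogonalIncrements F P B) (φ : SimpleAdapted F)
    (t : ℝ≥0) : AEStronglyMeasurable[F t] (φ.integral B t) P := by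
  refine aestronglyMeasurable_sum_of_le (f := fun j ω => φ.coeff j ω *
    (B (min (φ.right j) t) ω - B (min (φ.left j) t) ω)) Finset.univ fun j => ?_
  · rcases le_total (φ.left j) t with h | h
    · exact ((φ.measurable_coeff j).mono (F.mono h) le_rfl).stronglyMeasurable.aestronglyMeasurable.mul
        (hB.adapted_sub (min_le_right _ _) (min_le_right _ _))
    · simp only [min_eq_right h, min_eq_right (h.trans (φ.left_le_right j)), sub_self, mul_zero]
      exact aestronglyMeasurable_const

variable [IsProbabilityMeasure P]

theorem memLp_eval (φ : SimpleAdapted F) (t : ℝ≥0) :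
    MemLp (fun p : ℝ≥0 × Ω => φ.eval p.1 p.2) 2 (timeProd P t) := by
  obtain ⟨C, hC⟩ := φ.exists_abs_eval_le
  exact MemLp.of_bound φ.measurable_eval.aestronglyMeasurable C (.of_forall fun p => hC p.1 p.2)

/-- The isometry for elementary integrals with respect to two integrators. -/
theorem integral_integral_mul_integral (hB : HasOrthogonalIncrements F P B)
    (hB' : HasOrthogonalIncrements F P B') (hc : HasCovariation F P c B B')
    (φ ψ : SimpleAdapted F) (t : ℝ≥0) :
    ∫ ω, φ.integral B t ω * ψ.integral B' t ω ∂P =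
      c * ∫ p, φ.eval p.1 p.2 * ψ.eval p.1 p.2 ∂(timeProd P t) := by
  obtain ⟨C, hC⟩ := φ.bounded_coeff
  obtain ⟨C', hC'⟩ := ψ.bounded_coeff
  have hφ := fun j => ((φ.measurable_coeff j).mono (F.le _) le_rfl).aestronglyMeasurable (μ := P)
  have hψ := fun j => ((ψ.measurable_coeff j).mono (F.le _) le_rfl).aestronglyMeasurable (μ := P)
  simp_rw [integral, eval_eq, Finset.sum_mul_sum]
  have hind : ∀ a b : ℝ≥0, MemLp ((Set.Ioc a b).indicator fun _ => (1 : ℝ)) 2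
      (lebesgueNN.restrict (Set.Icc 0 t)) := fun a b =>
    (memLp_const 1).indicator measurableSet_Ioc
  have hco : ∀ (ξ : Ω → ℝ) (D : ℝ), AEStronglyMeasurable ξ P → (∀ ω, |ξ ω| ≤ D) → MemLp ξ 2 P :=
    fun ξ D h1 h2 => MemLp.of_bound h1 D (.of_forall h2)
  have key : ∀ i j, ∫ p : ℝ≥0 × Ω,
      ((Set.Ioc (φ.left i) (φ.right i)).indicator (fun _ => (1 : ℝ)) p.1 * φ.coeff i p.2) *
      ((Set.Ioc (ψ.left j) (ψ.right j)).indicator (fun _ => (1 : ℝ)) p.1 * ψ.coeff j p.2)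
        ∂(timeProd P t) = (lebesgueNN.restrict (Set.Icc 0 t)).real
          (Set.Ioc (φ.left i) (φ.right i) ∩ Set.Ioc (ψ.left j) (ψ.right j)) *
        ∫ ω, φ.coeff i ω * ψ.coeff j ω ∂P := by
    intro i j
    rw [integral_congr_ae (.of_forall fun p => mul_mul_mul_comm _ _ _ _),
      integral_prod_mul (fun s => (Set.Ioc (φ.left i) (φ.right i)).indicator (fun _ => (1 : ℝ)) s *
      (Set.Ioc (ψ.left j) (ψ.right j)).indicator (fun _ => (1 : ℝ)) s)
      (fun ω => φ.coeff i ω * ψ.coeff j ω)]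
    congr 1
    rw [← integral_indicator_one (measurableSet_Ioc.inter measurableSet_Ioc)]
    refine integral_congr_ae (.of_forall fun s => ?_)
    simp only [Set.indicator_apply, Set.mem_inter_iff, Pi.one_apply]
    split_ifs <;> simp_all
  have hi : ∀ i j, Integrable (fun ω =>
      φ.coeff i ω * (B (min (φ.right i) t) ω - B (min (φ.left i) t) ω) *
      (ψ.coeff j ω * (B' (min (ψ.right j) t) ω - B' (min (ψ.left j) t) ω))) P := fun i j =>
    (memLp_bdd_mul (hφ i) (hC i) (hB.memLp_sub _ _)).integrable_mul
      (memLp_bdd_mul (hψ j) (hC' j) (hB'.memLp_sub _ _))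
  have hj : ∀ i j, Integrable (fun p : ℝ≥0 × Ω =>
      ((Set.Ioc (φ.left i) (φ.right i)).indicator (fun _ => (1 : ℝ)) p.1 * φ.coeff i p.2) *
      ((Set.Ioc (ψ.left j) (ψ.right j)).indicator (fun _ => (1 : ℝ)) p.1 * ψ.coeff j p.2))
        (timeProd P t) := fun i j =>
    (((hind _ _).integrable_mul (hind _ _)).mul_prod ((hco _ _ (hφ i) (hC i)).integrable_mul
      (hco _ _ (hψ j) (hC' j)))).congr (.of_forall fun p => mul_mul_mul_comm _ _ _ _)
  rw [integral_finsetSum _ fun i _ => integrable_finsetSum _ fun j _ => hi i j,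
    integral_finsetSum _ fun i _ => integrable_finsetSum _ fun j _ => hj i j, Finset.mul_sum]
  refine Finset.sum_congr rfl fun i _ => ?_
  rw [integral_finsetSum _ fun j _ => hi i j, integral_finsetSum _ fun j _ => hj i j,
    Finset.mul_sum]
  refine Finset.sum_congr rfl fun j _ => ?_
  rw [key, hB.integral_stopped_term_mul_stopped_term hB' hc (φ.left_le_right i)
    (ψ.left_le_right j) (φ.measurable_coeff i) (ψ.measurable_coeff j) (hC i) (hC' j)]
  ring

/-- Elementary integrals are martingales. -/
theorem condExp_integral (hB : HasOrthogonalIncrements F P B) (φ : SimpleAdapted F) {t T : ℝ≥0}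
    (htT : t ≤ T) : P[φ.integral B T | F t] =ᵐ[P] φ.integral B t := by
  obtain ⟨C, hC⟩ := φ.bounded_coeff
  have hint := fun t => (φ.memLp_integral hB t).integrable one_le_two
  refine (ae_eq_condExp_of_forall_setIntegral_eq (F.le t) (hint T)
    (fun _ _ _ => (hint t).integrableOn) (fun A hA _ => ?_)
    (φ.aestronglyMeasurable_integral hB t)).symm
  have hA' : MeasurableSet A := F.le t A hA
  rw [eq_comm, ← sub_eq_zero, ← integral_sub (hint T).integrableOn (hint t).integrableOn,
    ← integral_indicator hA']
  -- Each remaining increment is written so as to start at `max (left j) t`, a time at which the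
  -- coefficient and the indicator of `A` are both known. Orthogonality of increments then kills
  -- every summand. Terms with `left j > T` contribute nothing.
  have e : ∀ ω, A.indicator (fun ω => φ.integral B T ω - φ.integral B t ω) ω =
      ∑ j, (A.indicator 1 ω * φ.coeff j ω * if φ.left j ≤ T then 1 else 0) *
        (B (max (min (φ.right j) T) (max (φ.left j) t)) ω - B (max (φ.left j) t) ω) := by
    intro ω
    by_cases hω : ω ∈ A
    · simp only [Set.indicator_of_mem hω, integral, ← Finset.sum_sub_distrib, Pi.one_apply, one_mul]
      refine Finset.sum_congr rfl fun j _ => ?_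
      have hlr := φ.left_le_right j
      split_ifs with hlT
      · rw [min_eq_left hlT]
        rcases le_total (φ.left j) t with h | h
        · rw [max_eq_right h, min_eq_left h]
          rcases le_total (φ.right j) t with h' | h'
          · rw [min_eq_left h', min_eq_left (h'.trans htT), max_eq_right h']; ring
          · rw [min_eq_right h', max_eq_left (le_min h' htT)]; ring
        · rw [max_eq_left h, min_eq_right h, min_eq_right (h.trans hlr),
            max_eq_left (le_min hlr hlT)]
          ring
      · have h1 : T ≤ φ.left j := (not_le.1 hlT).le
        rw [min_eq_right h1, min_eq_right (h1.trans hlr), min_eq_right (htT.trans h1),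
          min_eq_right ((htT.trans h1).trans hlr)]
        ring
    · simp [Set.indicator_of_notMem hω]
  simp_rw [e]
  have hZ : ∀ j, AEStronglyMeasurable[F (max (φ.left j) t)]
      (fun ω => A.indicator 1 ω * φ.coeff j ω * if φ.left j ≤ T then (1 : ℝ) else 0) P := by
    intro j
    refine StronglyMeasurable.aestronglyMeasurable ?_
    refine (StronglyMeasurable.mul ?_ ?_).mul stronglyMeasurable_const
    · exact stronglyMeasurable_one.indicator (F.mono (le_max_right _ _) A hA)
    · exact ((φ.measurable_coeff j).mono (F.mono (le_max_left _ _)) le_rfl).stronglyMeasurable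
  rw [integral_finsetSum]
  · exact Finset.sum_eq_zero fun j _ => hB.orthogonal _ _ (le_max_right _ _) _ (hZ j)
  · intro j _
    refine (memLp_bdd_mul (C := C) ((hZ j).mono (F.le _)) (fun ω => ?_)
      (hB.memLp_sub _ _)).integrable one_le_two
    rw [abs_mul, abs_mul]
    have h1 : |A.indicator (1 : Ω → ℝ) ω| ≤ 1 := by
      by_cases hω : ω ∈ A <;> simp [hω]
    have h2 : |if φ.left j ≤ T then (1 : ℝ) else 0| ≤ 1 := by split_ifs <;> simp
    calc _ ≤ 1 * |φ.coeff j ω| * 1 := by gcongr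
      _ ≤ C := by simpa using hC j ω

end SimpleAdapted

end Simple

section Density

/-! ### Density of simple processes among the adapted square-integrable processes -/

/-- An integrable function on the half-line with all integrals over `[0, b]` zero for almost every
second coordinate vanishes almost everywhere. -/
theorem ae_eq_zero_of_integral_Iic_eq_zero {Ω : Type*} {mΩ : MeasurableSpace Ω} {ν : Measure ℝ≥0}
    {P : Measure Ω} [IsFiniteMeasure ν] [IsFiniteMeasure P] {g : ℝ≥0 × Ω → ℝ}
    (hg : Integrable g (ν.prod P)) {T : ℝ≥0} (hT : ν (Set.Ioi T) = 0)
    (h : ∀ b, ∀ᵐ ω ∂P, ∫ s, (Set.Iic b).indicator (fun s => g (s, ω)) s ∂ν = 0) :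
    g =ᵐ[ν.prod P] 0 := by
  have rect : ∀ b D, MeasurableSet D → ∫ p in Set.Iic b ×ˢ D, g p ∂(ν.prod P) = 0 := by
    intro b D hD
    have hm : MeasurableSet (Set.Iic b ×ˢ D : Set (ℝ≥0 × Ω)) := measurableSet_Iic.prod hD
    rw [← integral_indicator hm, integral_prod_symm _ (hg.indicator hm)]
    refine integral_eq_zero_of_ae ?_
    filter_upwards [h b] with ω hω
    by_cases hωD : ω ∈ D
    · rw [Pi.zero_apply, ← hω]
      refine integral_congr_ae (.of_forall fun s => ?_)
      by_cases hs : s ≤ b <;> simp [hωD, hs]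
    · simp [hωD]
  -- The vanishing total integral is what closes the class of sets below under complements in the
  -- π-λ argument.
  have huniv : ∫ p, g p ∂(ν.prod P) = 0 := by
    rw [← rect T Set.univ MeasurableSet.univ, ← setIntegral_univ]
    refine setIntegral_congr_set (ae_eq_univ.2 ?_).symm
    have : (Set.Iic T ×ˢ Set.univ : Set (ℝ≥0 × Ω))ᶜ = Set.Ioi T ×ˢ Set.univ := by
      ext p; simp
    rw [this, Measure.prod_prod, hT, zero_mul]
  have hgen : (Prod.instMeasurableSpace : MeasurableSpace (ℝ≥0 × Ω)) =
      MeasurableSpace.generateFrom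
        (Set.image2 (· ×ˢ ·) (Set.range Set.Iic) {D : Set Ω | MeasurableSet D}) := by
    refine (generateFrom_eq_prod ?_ MeasurableSpace.generateFrom_measurableSet ?_
      isCountablySpanning_measurableSet).symm
    · rw [← borel_eq_generateFrom_Iic]
      exact (BorelSpace.measurable_eq (α := ℝ≥0)).symm
    · refine ⟨fun n : ℕ => Set.Iic (n : ℝ≥0), fun n => ⟨_, rfl⟩, ?_⟩
      exact Set.iUnion_eq_univ_iff.2 fun x => exists_nat_ge x
  refine hg.ae_eq_zero_of_forall_setIntegral_eq_zero fun S hS _ => ?_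
  refine MeasurableSpace.induction_on_inter
    (C := fun S _ => ∫ p in S, g p ∂(ν.prod P) = 0) hgen
    (isPiSystem_Iic.prod MeasurableSpace.isPiSystem_measurableSet) ?_ ?_ ?_ ?_ S hS
  · simp
  · rintro _ ⟨_, ⟨b, rfl⟩, D, hD, rfl⟩
    exact rect b D hD
  · intro S hS h0
    have := integral_add_compl hS hg
    rwa [h0, huniv, zero_add] at this
  · intro S hd hS h0
    rw [integral_iUnion hS hd hg.integrableOn]
    simp [h0]

/-- The integral of `γ(r) γ(s)` over `r < s` is half of the square of the integral of `γ`. -/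
theorem integral_mul_integral_Ioi {ν : Measure ℝ≥0} [IsFiniteMeasure ν] [NullSingletonClass ν]
    {γ : ℝ≥0 → ℝ} (hγ : Integrable γ ν) :
    ∫ r, γ r * ∫ s, (Set.Ioi r).indicator γ s ∂ν ∂ν = (∫ s, γ s ∂ν) ^ 2 / 2 := by
  have hprod : Integrable (fun p : ℝ≥0 × ℝ≥0 => γ p.1 * γ p.2) (ν.prod ν) := hγ.mul_prod hγ
  have hm : MeasurableSet {p : ℝ≥0 × ℝ≥0 | p.1 < p.2} := measurableSet_lt measurable_fst measurable_snd
  have hm' : MeasurableSet {p : ℝ≥0 × ℝ≥0 | p.2 < p.1} := measurableSet_lt measurable_snd measurable_fst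
  have e1 : ∫ r, γ r * ∫ s, (Set.Ioi r).indicator γ s ∂ν ∂ν =
      ∫ p, {p : ℝ≥0 × ℝ≥0 | p.1 < p.2}.indicator (fun p => γ p.1 * γ p.2) p ∂(ν.prod ν) := by
    rw [integral_prod _ (hprod.indicator hm)]
    refine integral_congr_ae (.of_forall fun r => ?_)
    simp only
    rw [← integral_const_mul]
    refine integral_congr_ae (.of_forall fun s => ?_)
    by_cases h : r < s <;> simp [h]
  -- The integrand is symmetric, so the two open triangles carry the same integral. The diagonal is
  -- null because `ν` has no atoms, so together they carry the integral over the whole square.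
  have e2 : ∫ p, {p : ℝ≥0 × ℝ≥0 | p.1 < p.2}.indicator (fun p => γ p.1 * γ p.2) p ∂(ν.prod ν) =
      ∫ p, {p : ℝ≥0 × ℝ≥0 | p.2 < p.1}.indicator (fun p => γ p.1 * γ p.2) p ∂(ν.prod ν) := by
    rw [← integral_prod_swap]
    refine integral_congr_ae (.of_forall fun p => ?_)
    by_cases h : p.2 < p.1 <;> simp [h, mul_comm]
  have hdiag : ∀ᵐ p ∂(ν.prod ν), p.1 ≠ p.2 := by
    have hd : MeasurableSet {p : ℝ≥0 × ℝ≥0 | p.1 ≠ p.2} :=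
      (measurableSet_eq_fun measurable_fst measurable_snd).compl
    rw [Measure.ae_prod_iff_ae_ae hd]
    refine .of_forall fun r => ?_
    rw [ae_iff]
    simp only [ne_eq, not_not]
    exact (measure_mono (by rintro s rfl; rfl)).trans (measure_singleton r).le |>.antisymm bot_le
  have e3 : ∫ p, {p : ℝ≥0 × ℝ≥0 | p.1 < p.2}.indicator (fun p => γ p.1 * γ p.2) p ∂(ν.prod ν) +
      ∫ p, {p : ℝ≥0 × ℝ≥0 | p.2 < p.1}.indicator (fun p => γ p.1 * γ p.2) p ∂(ν.prod ν) =
      (∫ s, γ s ∂ν) ^ 2 := by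
    rw [← integral_add (hprod.indicator hm) (hprod.indicator hm'), sq, ← integral_prod_mul]
    refine integral_congr_ae ?_
    filter_upwards [hdiag] with p hp
    rcases lt_or_gt_of_ne hp with h | h <;> simp [h, h.le]
  rw [e1]
  linarith

variable {Ω : Type*} {mΩ : MeasurableSpace Ω} {F : Filtration ℝ≥0 mΩ} {P : Measure Ω}

/-! ### The vector space of simple processes -/

namespace SimpleAdapted

/-- The simple process `1_(l, r] 1_A`. -/
def single (F : Filtration ℝ≥0 mΩ) {l r : ℝ≥0} (h : l ≤ r) {A : Set Ω}
    (hA : MeasurableSet[F l] A) : SimpleAdapted F where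
  n := 1
  left _ := l
  right _ := r
  left_le_right _ := h
  coeff _ := A.indicator 1
  measurable_coeff _ := (measurable_const : Measurable[F l] fun _ => (1 : ℝ)).indicator hA
  bounded_coeff := ⟨1, fun _ ω => by by_cases hω : ω ∈ A <;> simp [hω]⟩

theorem eval_single {l r : ℝ≥0} (h : l ≤ r) {A : Set Ω} (hA : MeasurableSet[F l] A) (s : ℝ≥0)
    (ω : Ω) : (single F h hA).eval s ω =
      (Set.Ioc l r).indicator 1 s * A.indicator (1 : Ω → ℝ) ω := by
  rw [eval_eq]
  exact Fin.sum_univ_one fun _ => (Set.Ioc l r).indicator (fun _ => (1 : ℝ)) s * A.indicator 1 ω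

/-- The simple process `0`. -/
def zero (F : Filtration ℝ≥0 mΩ) : SimpleAdapted F where
  n := 0
  left _ := 0
  right _ := 0
  left_le_right _ := le_rfl
  coeff _ := 0
  measurable_coeff _ := measurable_const
  bounded_coeff := ⟨0, by simp⟩

theorem eval_zero (s : ℝ≥0) (ω : Ω) : (zero F).eval s ω = 0 := by
  rw [eval_eq]
  exact Finset.sum_of_isEmpty (ι := Fin 0) _

/-- The multiple of a simple process by a real number. -/
def smul (a : ℝ) (φ : SimpleAdapted F) : SimpleAdapted F where
  n := φ.n
  left := φ.left
  right := φ.right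
  left_le_right := φ.left_le_right
  coeff j ω := a * φ.coeff j ω
  measurable_coeff j := (φ.measurable_coeff j).const_mul a
  bounded_coeff := by
    obtain ⟨C, hC⟩ := φ.bounded_coeff
    refine ⟨|a| * C, fun j ω => ?_⟩
    rw [abs_mul]
    exact mul_le_mul_of_nonneg_left (hC j ω) (abs_nonneg a)

theorem eval_smul (a : ℝ) (φ : SimpleAdapted F) (s : ℝ≥0) (ω : Ω) :
    (smul a φ).eval s ω = a * φ.eval s ω := by
  rw [eval_eq, eval_eq, Finset.mul_sum]
  exact Finset.sum_congr rfl fun j _ => mul_left_comm _ _ _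

/-- The sum of two simple processes. -/
def add (φ ψ : SimpleAdapted F) : SimpleAdapted F where
  n := φ.n + ψ.n
  left := Fin.append φ.left ψ.left
  right := Fin.append φ.right ψ.right
  left_le_right j := by
    refine Fin.addCases (fun i => ?_) (fun i => ?_) j
    · simpa using φ.left_le_right i
    · simpa using ψ.left_le_right i
  coeff := Fin.append φ.coeff ψ.coeff
  measurable_coeff j := by
    refine Fin.addCases (fun i => ?_) (fun i => ?_) j
    · rw [Fin.append_left, Fin.append_left]
      exact φ.measurable_coeff i
    · rw [Fin.append_right, Fin.append_right]
      exact ψ.measurable_coeff i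
  bounded_coeff := by
    obtain ⟨C, hC⟩ := φ.bounded_coeff
    obtain ⟨C', hC'⟩ := ψ.bounded_coeff
    refine ⟨max C C', fun j ω => ?_⟩
    refine Fin.addCases (fun i => ?_) (fun i => ?_) j
    · simpa using Or.inl (hC i ω)
    · simpa using Or.inr (hC' i ω)

theorem eval_add (φ ψ : SimpleAdapted F) (s : ℝ≥0) (ω : Ω) :
    (add φ ψ).eval s ω = φ.eval s ω + ψ.eval s ω := by
  rw [eval_eq, eval_eq, eval_eq]
  refine (Fin.sum_univ_add (a := φ.n) (b := ψ.n) _).trans ?_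
  simp [add]

end SimpleAdapted

variable [IsProbabilityMeasure P]

/-- The classes of simple processes in `L²([0, T] × Ω)`. -/
def simpleSubmodule (F : Filtration ℝ≥0 mΩ) (P : Measure Ω) [IsProbabilityMeasure P] (T : ℝ≥0) :
    Submodule ℝ (Lp ℝ 2 (timeProd P T)) where
  carrier := {x | ∃ φ : SimpleAdapted F, x =ᵐ[timeProd P T] fun p => φ.eval p.1 p.2}
  zero_mem' := ⟨.zero F, by
    filter_upwards [Lp.coeFn_zero ℝ 2 (timeProd P T)] with p hp
    rw [hp, SimpleAdapted.eval_zero, Pi.zero_apply]⟩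
  add_mem' := by
    rintro x y ⟨φ, hφ⟩ ⟨ψ, hψ⟩
    refine ⟨φ.add ψ, ?_⟩
    filter_upwards [Lp.coeFn_add x y, hφ, hψ] with p hp h1 h2
    rw [hp, Pi.add_apply, h1, h2, SimpleAdapted.eval_add]
  smul_mem' := by
    rintro a x ⟨φ, hφ⟩
    refine ⟨φ.smul a, ?_⟩
    filter_upwards [Lp.coeFn_smul a x, hφ] with p hp h1
    rw [hp, Pi.smul_apply, h1, SimpleAdapted.eval_smul, smul_eq_mul]

/-- The integral of `g(·, ω)` over `(r, b]`. -/
def tailIntegral (T : ℝ≥0) (g : ℝ≥0 × Ω → ℝ) (b : ℝ≥0) (p : ℝ≥0 × Ω) : ℝ :=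
  ∫ s, (Set.Ioc p.1 b).indicator (fun s => g (s, p.2)) s ∂(lebesgueNN.restrict (Set.Icc 0 T))

/-- The integral of `|g(·, ω)|` over `[0, T]` is square-integrable. -/
theorem memLp_integral_norm {T : ℝ≥0} {g : ℝ≥0 × Ω → ℝ} (hg : StronglyMeasurable g)
    (hg2 : MemLp g 2 (timeProd P T)) :
    MemLp (fun ω => ∫ s, ‖g (s, ω)‖ ∂(lebesgueNN.restrict (Set.Icc 0 T))) 2 P := by
  set ν := lebesgueNN.restrict (Set.Icc 0 T) with hν
  refine ⟨(StronglyMeasurable.integral_prod_left' (f := fun p : ℝ≥0 × Ω => ‖g p‖)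
    hg.norm).aestronglyMeasurable, ?_⟩
  refine (eLpNorm_lt_top_iff_lintegral_rpow_enorm_lt_top (by simp) (by simp)).2 ?_
  have hfin := (eLpNorm_lt_top_iff_lintegral_rpow_enorm_lt_top (by simp) (by simp)).1 hg2.2
  simp only [ENNReal.toReal_ofNat, ENNReal.rpow_ofNat] at hfin ⊢
  rw [lintegral_prod_symm _ (hg.enorm.pow_const 2).aemeasurable] at hfin
  -- Cauchy–Schwarz in time, expressed as the comparison of `L¹` and `L²` norms on a finite measure
  -- space.
  have hle : ∀ ω, ‖∫ s, ‖g (s, ω)‖ ∂ν‖ₑ ^ 2 ≤ ν Set.univ * ∫⁻ s, ‖g (s, ω)‖ₑ ^ 2 ∂ν := by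
    intro ω
    have hs : AEStronglyMeasurable (fun s => g (s, ω)) ν :=
      (hg.comp_measurable measurable_prodMk_right).aestronglyMeasurable
    have h1 : ‖∫ s, ‖g (s, ω)‖ ∂ν‖ₑ ≤ eLpNorm (fun s => g (s, ω)) 1 ν := by
      rw [eLpNorm_one_eq_lintegral_enorm]
      refine (enorm_integral_le_lintegral_enorm _).trans_eq ?_
      simp
    have h2 := eLpNorm_le_eLpNorm_mul_rpow_measure_univ (p := 1) (q := 2) one_le_two hs
    have h3 : eLpNorm (fun s => g (s, ω)) 2 ν ^ 2 = ∫⁻ s, ‖g (s, ω)‖ₑ ^ 2 ∂ν := by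
      simpa using eLpNorm_nnreal_pow_eq_lintegral (p := 2) (by simp) (f := fun s => g (s, ω)) (μ := ν)
    have h4 : (ν Set.univ ^ (1 / (1 : ℝ≥0∞).toReal - 1 / (2 : ℝ≥0∞).toReal)) ^ 2 =
        ν Set.univ := by
      rw [← ENNReal.rpow_natCast, ← ENNReal.rpow_mul]
      norm_num
    calc _ ≤ (eLpNorm (fun s => g (s, ω)) 2 ν *
          ν Set.univ ^ (1 / (1 : ℝ≥0∞).toReal - 1 / (2 : ℝ≥0∞).toReal)) ^ 2 := by
            gcongr; exact h1.trans h2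
      _ = _ := by rw [mul_pow, h3, h4, mul_comm]
  refine (lintegral_mono hle).trans_lt ?_
  rw [lintegral_const_mul']
  · exact ENNReal.mul_lt_top (measure_lt_top _ _) hfin
  · exact measure_ne_top _ _

theorem stronglyMeasurable_tailIntegral (T : ℝ≥0) {g : ℝ≥0 × Ω → ℝ} (hg : StronglyMeasurable g)
    (b : ℝ≥0) : StronglyMeasurable (tailIntegral T g b) := by
  have hm : MeasurableSet {q : (ℝ≥0 × Ω) × ℝ≥0 | q.1.1 < q.2 ∧ q.2 ≤ b} :=
    (measurableSet_lt (by fun_prop) (by fun_prop)).inter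
      (measurableSet_le (by fun_prop) (by fun_prop))
  have : StronglyMeasurable fun q : (ℝ≥0 × Ω) × ℝ≥0 =>
      {q : (ℝ≥0 × Ω) × ℝ≥0 | q.1.1 < q.2 ∧ q.2 ≤ b}.indicator (fun q => g (q.2, q.1.2)) q :=
    (hg.comp_measurable (by fun_prop)).indicator hm
  exact this.integral_prod_right'

theorem abs_tailIntegral_le (T : ℝ≥0) {g : ℝ≥0 × Ω → ℝ} (b : ℝ≥0) (p : ℝ≥0 × Ω)
    (hp : Integrable (fun s => g (s, p.2)) (lebesgueNN.restrict (Set.Icc 0 T))) :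
    ‖tailIntegral T g b p‖ ≤ ∫ s, ‖g (s, p.2)‖ ∂(lebesgueNN.restrict (Set.Icc 0 T)) := by
  refine norm_integral_le_of_norm_le hp.norm (.of_forall fun s => ?_)
  exact norm_indicator_le_norm_self _ _

theorem memLp_tailIntegral {T : ℝ≥0} {g : ℝ≥0 × Ω → ℝ} (hg : StronglyMeasurable g)
    (hg2 : MemLp g 2 (timeProd P T)) (b : ℝ≥0) : MemLp (tailIntegral T g b) 2 (timeProd P T) := by
  refine ((memLp_integral_norm hg hg2).comp_snd (lebesgueNN.restrict (Set.Icc 0 T))).mono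
    (stronglyMeasurable_tailIntegral T hg b).aestronglyMeasurable ?_
  have h1 := (hg2.integrable one_le_two).prod_left_ae
  filter_upwards [Measure.quasiMeasurePreserving_snd.ae h1] with p hp
  exact (abs_tailIntegral_le T b p hp).trans (Real.le_norm_self _)

theorem memLp_tailIntegral_section {T : ℝ≥0} {g : ℝ≥0 × Ω → ℝ} (hg : StronglyMeasurable g)
    (hg2 : MemLp g 2 (timeProd P T)) (r b : ℝ≥0) :
    MemLp (fun ω => tailIntegral T g b (r, ω)) 2 P := by
  refine (memLp_integral_norm hg hg2).mono ((stronglyMeasurable_tailIntegral T hg b).comp_measurable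
    measurable_prodMk_left).aestronglyMeasurable ?_
  filter_upwards [(hg2.integrable one_le_two).prod_left_ae] with ω hω
  exact (abs_tailIntegral_le T b (r, ω) hω).trans (Real.le_norm_self _)

/-- If `g` is orthogonal to the simple processes, then the integral of `g` over `(r, b]` is
orthogonal to the square-integrable `F r`-measurable random variables. -/
theorem integral_mul_tailIntegral {T : ℝ≥0} {g : ℝ≥0 × Ω → ℝ} (hg : StronglyMeasurable g)
    (hg2 : MemLp g 2 (timeProd P T))
    (horth : ∀ φ : SimpleAdapted F, ∫ p, g p * φ.eval p.1 p.2 ∂(timeProd P T) = 0) (r b : ℝ≥0)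
    {Z : Ω → ℝ} (hZ : AEStronglyMeasurable[F r] Z P) (hZ2 : MemLp Z 2 P) :
    ∫ ω, Z ω * tailIntegral T g b (r, ω) ∂P = 0 := by
  rcases le_or_gt r b with hrb | hrb
  swap
  · simp [tailIntegral, Set.Ioc_eq_empty (not_lt.2 hrb.le)]
  have hY := memLp_tailIntegral_section hg hg2 r b
  have hYi := hY.integrable one_le_two
  -- For `A` in `F r` the process `1_(r, b] 1_A` is simple, so by Fubini the tail integral has zero
  -- integral over `A`. Its conditional expectation given `F r` therefore vanishes, and `Z` can be
  -- pulled out.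
  have hc : (0 : Ω → ℝ) =ᵐ[P] P[fun ω => tailIntegral T g b (r, ω) | F r] := by
    refine ae_eq_condExp_of_forall_setIntegral_eq (F.le r) hYi
      (fun _ _ _ => integrableOn_zero) (fun A hA _ => ?_) aestronglyMeasurable_zero
    have hA' := F.le r A hA
    have h0 := horth (.single F hrb hA)
    rw [integral_prod_symm] at h0
    · simp only [Pi.zero_apply, integral_zero]
      rw [← integral_indicator hA', ← h0]
      refine integral_congr_ae (.of_forall fun ω => ?_)
      simp only [SimpleAdapted.eval_single]
      by_cases hω : ω ∈ A
      · simp only [hω, Set.indicator_of_mem, tailIntegral, Pi.one_apply, mul_one]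
        refine integral_congr_ae (.of_forall fun s => ?_)
        by_cases hs : s ∈ Set.Ioc r b <;> simp [hs]
      · simp [hω]
    · exact hg2.integrable_mul (SimpleAdapted.memLp_eval _ T)
  have hpull := condExp_mul_of_aestronglyMeasurable_left hZ (hZ2.integrable_mul hY) hYi
  change ∫ ω, (Z * fun ω => tailIntegral T g b (r, ω)) ω ∂P = 0
  rw [← integral_condExp (F.le r), integral_congr_ae hpull]
  refine integral_eq_zero_of_ae ?_
  filter_upwards [hc] with ω hω
  rw [Pi.mul_apply, ← hω, Pi.zero_apply, mul_zero]

/-- Fubini reduces the claim to each fixed time `r`, where `h(r, ·)` plays the role of `Z`.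
Adaptedness is used one time at a time, so progressive measurability plays no role. -/
theorem integral_adapted_mul_tailIntegral {T : ℝ≥0} {g h : ℝ≥0 × Ω → ℝ} (hg : StronglyMeasurable g)
    (hg2 : MemLp g 2 (timeProd P T))
    (horth : ∀ φ : SimpleAdapted F, ∫ p, g p * φ.eval p.1 p.2 ∂(timeProd P T) = 0) (b : ℝ≥0)
    (hh : ∀ r, AEStronglyMeasurable[F r] (fun ω => h (r, ω)) P)
    (hh2 : MemLp h 2 (timeProd P T)) :
    ∫ p, h p * tailIntegral T g b p ∂(timeProd P T) = 0 := by
  rw [integral_prod (fun p => h p * tailIntegral T g b p)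
    (hh2.integrable_mul (memLp_tailIntegral hg hg2 b))]
  refine integral_eq_zero_of_ae ?_
  have hsq : Integrable (fun p => h p ^ 2) (timeProd P T) := hh2.integrable_sq
  filter_upwards [hsq.prod_right_ae] with r hr
  exact integral_mul_tailIntegral hg hg2 horth r b (hh r)
    ((memLp_two_iff_integrable_sq ((hh r).mono (F.le r))).2 hr)

/-- If `g` is orthogonal to its own tail integrals, then `g = 0`. -/
theorem ae_eq_zero_of_integral_mul_tailIntegral {T : ℝ≥0} {g : ℝ≥0 × Ω → ℝ}
    (hg : StronglyMeasurable g) (hg2 : MemLp g 2 (timeProd P T))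
    (h : ∀ b, ∫ p, g p * tailIntegral T g b p ∂(timeProd P T) = 0) : g =ᵐ[timeProd P T] 0 := by
  have hgi := hg2.integrable one_le_two
  refine ae_eq_zero_of_integral_Iic_eq_zero (T := T) hgi ?_ fun b => ?_
  · rw [Measure.restrict_apply measurableSet_Ioi]
    convert measure_empty (μ := lebesgueNN)
    ext x
    simp
  have hi := hg2.integrable_mul (memLp_tailIntegral hg hg2 b)
  have h1 := h b
  rw [integral_prod_symm (fun p => g p * tailIntegral T g b p) hi] at h1
  -- For almost every `ω` the pairing in time is half the square of the integral of `g(·, ω)` over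
  -- `[0, b]`. A nonnegative variable with zero expectation vanishes almost surely, for each `b`.
  have e : ∀ᵐ ω ∂P, ∫ r, g (r, ω) * tailIntegral T g b (r, ω) ∂(lebesgueNN.restrict (Set.Icc 0 T)) =
      (∫ s, (Set.Iic b).indicator (fun s => g (s, ω)) s ∂(lebesgueNN.restrict (Set.Icc 0 T))) ^ 2 / 2 := by
    filter_upwards [hgi.prod_left_ae] with ω hω
    rw [← integral_mul_integral_Ioi (hω.indicator measurableSet_Iic)]
    refine integral_congr_ae (.of_forall fun r => ?_)
    simp only [tailIntegral]
    by_cases hr : r ≤ b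
    · rw [Set.indicator_of_mem (show r ∈ Set.Iic b from hr)]
      congr 1
      refine integral_congr_ae (.of_forall fun s => ?_)
      by_cases h1 : r < s <;> by_cases h2 : s ≤ b <;> simp [h1, h2]
    · rw [Set.indicator_of_notMem (show r ∉ Set.Iic b from hr), zero_mul,
        Set.Ioc_eq_empty (fun h => hr h.le)]
      simp
  have hint : Integrable
      (fun ω => (∫ s, (Set.Iic b).indicator (fun s => g (s, ω)) s ∂(lebesgueNN.restrict (Set.Icc 0 T))) ^ 2 / 2) P :=
    (hi.integral_prod_right).congr e
  rw [integral_congr_ae e, integral_eq_zero_iff_of_nonneg (fun ω => by positivity) hint] at h1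
  filter_upwards [h1] with ω hω
  simpa using hω

/-- Every adapted process in `L²([0, T] × Ω)` is a limit of simple processes. -/
theorem exists_tendsto_simpleAdapted {T : ℝ≥0} {f : ℝ≥0 × Ω → ℝ}
    (hf : ∀ r, AEStronglyMeasurable[F r] (fun ω => f (r, ω)) P)
    (hf2 : MemLp f 2 (timeProd P T)) :
    ∃ φ : ℕ → SimpleAdapted F,
      Tendsto (fun n => eLpNorm (fun p => f p - (φ n).eval p.1 p.2) 2 (timeProd P T)) atTop
        (𝓝 0) := by
  set S := simpleSubmodule F P T with hS
  set x : Lp ℝ 2 (timeProd P T) := hf2.toLp f with hx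
  have hxf : x =ᵐ[timeProd P T] f := hf2.coeFn_toLp
  suffices hmem : x ∈ S.topologicalClosure by
    obtain ⟨y, hyS, hy⟩ := mem_closure_iff_seq_limit.1 (show x ∈ closure (S : Set _) from hmem)
    choose φ hφ using hyS
    refine ⟨φ, ?_⟩
    rw [tendsto_iff_norm_sub_tendsto_zero] at hy
    have hy' := (ENNReal.continuous_ofReal.tendsto 0).comp hy
    rw [ENNReal.ofReal_zero] at hy'
    refine hy'.congr fun n => ?_
    rw [Function.comp_apply, norm_sub_rev, Lp.norm_def, ENNReal.ofReal_toReal (Lp.eLpNorm_ne_top _)]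
    refine eLpNorm_congr_ae ?_
    filter_upwards [Lp.coeFn_sub x (y n), hxf, hφ n] with p h1 h2 h3
    rw [h1, Pi.sub_apply, h2, h3]
  -- The orthogonal component `z` is shown to vanish. Its representative `g` is not known to be
  -- adapted, so the results for adapted processes are applied to `x` and to simple processes
  -- instead.
  obtain ⟨p, hp, z, hz, hxz⟩ := S.topologicalClosure.exists_add_mem_mem_orthogonal x
  rw [Submodule.orthogonal_closure] at hz
  suffices z = 0 by rw [hxz, this, add_zero]; exact hp
  obtain ⟨g, hg, hzg⟩ := Lp.aestronglyMeasurable z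
  have hg2 : MemLp g 2 (timeProd P T) := (memLp_congr_ae hzg).1 (Lp.memLp z)
  have horth : ∀ φ : SimpleAdapted F, ∫ p, g p * φ.eval p.1 p.2 ∂(timeProd P T) = 0 := by
    intro φ
    have h1 := hz _ (show (φ.memLp_eval T (P := P)).toLp _ ∈ S from ⟨φ, MemLp.coeFn_toLp _⟩)
    rw [real_inner_comm, L2.inner_def] at h1
    rw [← h1]
    refine integral_congr_ae ?_
    filter_upwards [hzg, (φ.memLp_eval T (P := P)).coeFn_toLp] with q h2 h3
    rw [h2, h3]
    simp [mul_comm]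
  have hgz : g =ᵐ[timeProd P T] 0 := by
    refine ae_eq_zero_of_integral_mul_tailIntegral hg hg2 fun b => ?_
    set y : Lp ℝ 2 (timeProd P T) := (memLp_tailIntegral hg hg2 b).toLp _ with hy
    have hyg : y =ᵐ[timeProd P T] tailIntegral T g b := MemLp.coeFn_toLp _
    -- The tail integral `y` is orthogonal to `p`, a limit of simple processes, and to the adapted
    -- `x`; hence also to `z = x - p`.
    have hySorth : y ∈ S.topologicalClosureᗮ := by
      rw [Submodule.orthogonal_closure, Submodule.mem_orthogonal]
      rintro w ⟨φ, hφ⟩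
      rw [L2.inner_def, ← integral_adapted_mul_tailIntegral hg hg2 horth b
        (fun r => (φ.stronglyMeasurable_eval r).aestronglyMeasurable) (φ.memLp_eval T)]
      refine integral_congr_ae ?_
      filter_upwards [hyg, hφ] with q h2 h3
      rw [h2, h3]
      simp [mul_comm]
    have hxy : inner ℝ x y = 0 := by
      rw [L2.inner_def, ← integral_adapted_mul_tailIntegral hg hg2 horth b hf hf2]
      refine integral_congr_ae ?_
      filter_upwards [hyg, hxf] with q h2 h3
      rw [h2, h3]
      simp [mul_comm]
    have hpy : inner ℝ p y = 0 := hySorth p hp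
    have hzy : inner ℝ z y = 0 := by
      rw [hxz, inner_add_left, hpy, zero_add] at hxy
      exact hxy
    rw [← hzy, L2.inner_def]
    refine integral_congr_ae ?_
    filter_upwards [hyg, hzg] with q h2 h3
    rw [h2, h3]
    simp [mul_comm]
  exact (Lp.eq_zero_iff_ae_eq_zero).2 (hzg.trans hgz)

end Density

section CondExp

/-! ### Conditional expectation on `L²(Ω)` -/

variable {Ω : Type*} {m m₀ : MeasurableSpace Ω}

/-- The conditional expectation as a bounded operator on `L²(Ω)`. -/
def condExpLp (P : Measure Ω) (hm : m ≤ m₀) : Lp ℝ 2 P →L[ℝ] Lp ℝ 2 P :=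
  (lpMeas ℝ ℝ m 2 P).subtypeL.comp (condExpL2 ℝ ℝ hm)

theorem condExpLp_toLp_ae_eq {P : Measure Ω} [IsFiniteMeasure P] (hm : m ≤ m₀)
    {f : Ω → ℝ} (hf : MemLp f 2 P) : condExpLp P hm (hf.toLp f) =ᵐ[P] P[f | m] :=
  hf.condExpL2_ae_eq_condExp (𝕜 := ℝ) hm

theorem condExpLp_ae_eq {P : Measure Ω} [IsFiniteMeasure P] (hm : m ≤ m₀)
    (x : Lp ℝ 2 P) : condExpLp P hm x =ᵐ[P] P[x | m] := by
  have := condExpLp_toLp_ae_eq hm (Lp.memLp x)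
  rwa [Lp.toLp_coeFn] at this

end CondExp

section Ito

variable {Ω : Type*} {mΩ : MeasurableSpace Ω} {F : Filtration ℝ≥0 mΩ} {P : Measure Ω}

/-! ### The Itô integral -/

/-- This permits replacing an integrand controlled only on `[0, T]` by its stopped version, which is
adapted at all times. -/
theorem IsItoIntegral.congr {B f g : ℝ≥0 → Ω → ℝ} {t : ℝ≥0} {I : Lp ℝ 2 P}
    (h : IsItoIntegral F P B f t I) (hfg : ∀ s ≤ t, f s = g s) : IsItoIntegral F P B g t I := by
  obtain ⟨φ, h1, h2⟩ := h
  refine ⟨φ, h1.congr fun n => ?_, h2⟩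
  refine setLIntegral_congr_fun measurableSet_Icc fun s hs => ?_
  simp only [hfg s hs.2]

variable [IsProbabilityMeasure P]

theorem lintegral_lintegral_enorm_sq {t : ℝ≥0} {h : ℝ≥0 → Ω → ℝ}
    (hh : AEStronglyMeasurable (fun p : ℝ≥0 × Ω => h p.1 p.2) (timeProd P t)) :
    ∫⁻ s in Set.Icc 0 t, ∫⁻ ω, ‖h s ω‖ₑ ^ 2 ∂P ∂lebesgueNN =
      eLpNorm (fun p : ℝ≥0 × Ω => h p.1 p.2) 2 (timeProd P t) ^ 2 := by
  have := eLpNorm_nnreal_pow_eq_lintegral (p := 2) (by simp) (f := fun p : ℝ≥0 × Ω => h p.1 p.2)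
    (μ := timeProd P t)
  simp only [NNReal.coe_ofNat, ENNReal.rpow_ofNat, ENNReal.coe_ofNat] at this
  rw [this, lintegral_prod _ (hh.enorm.pow_const 2)]

theorem tendsto_lintegral_lintegral_iff {t : ℝ≥0} {h : ℕ → ℝ≥0 → Ω → ℝ}
    (hh : ∀ n, AEStronglyMeasurable (fun p : ℝ≥0 × Ω => h n p.1 p.2) (timeProd P t)) :
    Tendsto (fun n => ∫⁻ s in Set.Icc 0 t, ∫⁻ ω, ‖h n s ω‖ₑ ^ 2 ∂P ∂lebesgueNN) atTop (𝓝 0) ↔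
      Tendsto (fun n => eLpNorm (fun p : ℝ≥0 × Ω => h n p.1 p.2) 2 (timeProd P t)) atTop
        (𝓝 0) := by
  simp_rw [fun n => lintegral_lintegral_enorm_sq (hh n)]
  constructor
  · intro H
    have := (ENNReal.continuous_rpow_const (y := 2⁻¹)).tendsto 0 |>.comp H
    rw [ENNReal.zero_rpow_of_pos (by norm_num)] at this
    refine this.congr fun n => ?_
    rw [Function.comp_apply, ← ENNReal.rpow_natCast, ← ENNReal.rpow_mul]
    norm_num
  · intro H
    have := (ENNReal.continuous_pow 2).tendsto 0 |>.comp H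
    rw [zero_pow two_ne_zero] at this
    exact this

/-- The existence of approximating sequences in terms of convergence in `L²`. -/
theorem isItoIntegral_iff {B f : ℝ≥0 → Ω → ℝ} (hB : HasOrthogonalIncrements F P B) {t : ℝ≥0}
    (hf : MemLp (fun p : ℝ≥0 × Ω => f p.1 p.2) 2 (timeProd P t)) {I : Lp ℝ 2 P} :
    IsItoIntegral F P B f t I ↔ ∃ φ : ℕ → SimpleAdapted F,
      Tendsto (fun n => ((φ n).memLp_eval t (P := P)).toLp _) atTop (𝓝 (hf.toLp _)) ∧
      Tendsto (fun n => ((φ n).memLp_integral hB t).toLp _) atTop (𝓝 I) := by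
  refine exists_congr fun φ => and_congr ?_ ?_
  · rw [Lp.tendsto_Lp_iff_tendsto_eLpNorm'' (fun n => _), tendsto_lintegral_lintegral_iff
      (h := fun n s ω => f s ω - (φ n).eval s ω)
      fun n => hf.1.sub ((φ n).memLp_eval t (P := P)).1]
    refine tendsto_congr fun n => ?_
    rw [eLpNorm_sub_comm]
    rfl
  · conv_rhs => rw [← Lp.toLp_coeFn I (Lp.memLp I)]
    rw [Lp.tendsto_Lp_iff_tendsto_eLpNorm'']
    rfl

/-- The isometry for Itô integrals with respect to two integrators. -/
theorem IsItoIntegral.inner_eq {B B' f g : ℝ≥0 → Ω → ℝ} {c : ℝ}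
    (hB : HasOrthogonalIncrements F P B) (hB' : HasOrthogonalIncrements F P B')
    (hc : HasCovariation F P c B B') {t : ℝ≥0}
    (hf : MemLp (fun p : ℝ≥0 × Ω => f p.1 p.2) 2 (timeProd P t))
    (hg : MemLp (fun p : ℝ≥0 × Ω => g p.1 p.2) 2 (timeProd P t)) {I I' : Lp ℝ 2 P}
    (hI : IsItoIntegral F P B f t I) (hI' : IsItoIntegral F P B' g t I') :
    inner ℝ I I' = c * inner ℝ (hf.toLp _) (hg.toLp _) := by
  obtain ⟨φ, h1, h2⟩ := (isItoIntegral_iff hB hf).1 hI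
  obtain ⟨ψ, h3, h4⟩ := (isItoIntegral_iff hB' hg).1 hI'
  -- By continuity of the inner product, both sides are limits of the identity for simple processes.
  refine tendsto_nhds_unique (h2.inner h4) (((h1.inner h3).const_mul c).congr fun n => ?_)
  rw [L2.inner_def, L2.inner_def]
  have e1 : ∫ ω, (φ n).integral B t ω * (ψ n).integral B' t ω ∂P = ∫ ω, inner ℝ
      (((φ n).memLp_integral hB t).toLp _ ω) (((ψ n).memLp_integral hB' t).toLp _ ω) ∂P := by
    refine integral_congr_ae ?_
    filter_upwards [((φ n).memLp_integral hB t).coeFn_toLp,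
      ((ψ n).memLp_integral hB' t).coeFn_toLp] with ω h5 h6
    rw [h5, h6]
    simp [mul_comm]
  rw [← e1, SimpleAdapted.integral_integral_mul_integral hB hB' hc]
  congr 1
  refine integral_congr_ae ?_
  filter_upwards [((φ n).memLp_eval t (P := P)).coeFn_toLp,
      ((ψ n).memLp_eval t (P := P)).coeFn_toLp] with ω h5 h6
  rw [h5, h6]
  simp [mul_comm]

theorem SimpleAdapted.isItoIntegral {B : ℝ≥0 → Ω → ℝ} (hB : HasOrthogonalIncrements F P B)
    (φ : SimpleAdapted F) (t : ℝ≥0) :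
    IsItoIntegral F P B φ.eval t ((φ.memLp_integral hB t).toLp _) :=
  (isItoIntegral_iff hB (φ.memLp_eval t)).2
    ⟨fun _ => φ, tendsto_const_nhds, tendsto_const_nhds⟩

/-- The distance of two Itô integrals with respect to the same Brownian motion. -/
theorem IsItoIntegral.norm_sub_eq {B f g : ℝ≥0 → Ω → ℝ} (hB : HasOrthogonalIncrements F P B)
    (hc : HasCovariation F P 1 B B) {t : ℝ≥0}
    (hf : MemLp (fun p : ℝ≥0 × Ω => f p.1 p.2) 2 (timeProd P t))
    (hg : MemLp (fun p : ℝ≥0 × Ω => g p.1 p.2) 2 (timeProd P t)) {I J : Lp ℝ 2 P}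
    (hI : IsItoIntegral F P B f t I) (hJ : IsItoIntegral F P B g t J) :
    ‖I - J‖ = ‖hf.toLp _ - hg.toLp _‖ := by
  -- Expanding both squares leaves only inner products, so additivity of the integral in the
  -- integrand is not needed.
  rw [← sq_eq_sq₀ (norm_nonneg _) (norm_nonneg _), norm_sub_sq_real, norm_sub_sq_real,
    ← real_inner_self_eq_norm_sq, ← real_inner_self_eq_norm_sq, ← real_inner_self_eq_norm_sq,
    ← real_inner_self_eq_norm_sq, hI.inner_eq hB hB hc hf hf hI, hJ.inner_eq hB hB hc hg hg hJ,
    hI.inner_eq hB hB hc hf hg hJ]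
  ring

theorem IsItoIntegral.unique {B f : ℝ≥0 → Ω → ℝ} (hB : HasOrthogonalIncrements F P B)
    (hc : HasCovariation F P 1 B B) {t : ℝ≥0}
    (hf : MemLp (fun p : ℝ≥0 × Ω => f p.1 p.2) 2 (timeProd P t)) {I J : Lp ℝ 2 P}
    (hI : IsItoIntegral F P B f t I) (hJ : IsItoIntegral F P B f t J) : I = J := by
  rw [← sub_eq_zero, ← norm_eq_zero, hI.norm_sub_eq hB hc hf hf hJ, sub_self, norm_zero]

/-- By density `f` is a limit of simple processes; the isometry makes their elementary integrals a
Cauchy sequence in `L²(Ω)`. -/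
theorem exists_isItoIntegral {B f : ℝ≥0 → Ω → ℝ} (hB : HasOrthogonalIncrements F P B)
    (hc : HasCovariation F P 1 B B) {t : ℝ≥0}
    (hfa : ∀ s, AEStronglyMeasurable[F s] (f s) P)
    (hf : MemLp (fun p : ℝ≥0 × Ω => f p.1 p.2) 2 (timeProd P t)) :
    ∃ I, IsItoIntegral F P B f t I := by
  obtain ⟨φ, hφ⟩ := exists_tendsto_simpleAdapted (f := fun p : ℝ≥0 × Ω => f p.1 p.2) hfa hf
  have h1 : Tendsto (fun n => ((φ n).memLp_eval t (P := P)).toLp _) atTop (𝓝 (hf.toLp _)) := by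
    rw [Lp.tendsto_Lp_iff_tendsto_eLpNorm'' (fun n => _)]
    refine hφ.congr fun n => ?_
    rw [eLpNorm_sub_comm]
    rfl
  have h2 : CauchySeq fun n => ((φ n).memLp_integral hB t).toLp _ := by
    have h3 := h1.cauchySeq
    rw [cauchySeq_iff_tendsto_dist_atTop_0] at h3 ⊢
    refine h3.congr fun p => ?_
    rw [dist_eq_norm, dist_eq_norm]
    exact (((φ p.1).isItoIntegral hB t).norm_sub_eq hB hc _ _ ((φ p.2).isItoIntegral hB t)).symm
  obtain ⟨I, hI⟩ := cauchySeq_tendsto_of_complete h2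
  exact ⟨I, (isItoIntegral_iff hB hf).2 ⟨φ, h1, hI⟩⟩

theorem SimpleAdapted.condExpLp_integral {B : ℝ≥0 → Ω → ℝ} (hB : HasOrthogonalIncrements F P B)
    (φ : SimpleAdapted F) {t T : ℝ≥0} (htT : t ≤ T) :
    condExpLp P (F.le t) ((φ.memLp_integral hB T).toLp _) = (φ.memLp_integral hB t).toLp _ :=
  Lp.ext ((condExpLp_toLp_ae_eq _ _).trans
    ((φ.condExp_integral hB htT).trans (MemLp.coeFn_toLp _).symm))

/-- The Itô integral is a martingale. -/
theorem IsItoIntegral.condExpLp {B f : ℝ≥0 → Ω → ℝ} (hB : HasOrthogonalIncrements F P B)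
    {t T : ℝ≥0} (htT : t ≤ T) (hf : MemLp (fun p : ℝ≥0 × Ω => f p.1 p.2) 2 (timeProd P T))
    {I : Lp ℝ 2 P} (hI : IsItoIntegral F P B f T I) :
    IsItoIntegral F P B f t (condExpLp P (F.le t) I) := by
  have hle : timeProd P t ≤ timeProd P T :=
    Measure.prod_mono (Measure.restrict_mono (Set.Icc_subset_Icc_right htT) le_rfl) le_rfl
  obtain ⟨φ, h1, h2⟩ := (isItoIntegral_iff hB hf).1 hI
  -- The simple processes that approximate on `[0, T]` also approximate on `[0, t]`.
  refine (isItoIntegral_iff hB (hf.mono_measure hle)).2 ⟨φ, ?_, ?_⟩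
  · rw [Lp.tendsto_Lp_iff_tendsto_eLpNorm'' (fun n => _)] at h1 ⊢
    exact tendsto_of_tendsto_of_tendsto_of_le_of_le tendsto_const_nhds h1 (fun _ => bot_le)
      fun n => eLpNorm_mono_measure _ hle
  · refine (((_root_.condExpLp P (F.le t)).continuous.tendsto I).comp h2).congr fun n => ?_
    exact (φ n).condExpLp_integral hB htT

end Ito

section Dyadic

/-! ### Dyadic approximation of time -/

/-- The largest multiple of `2⁻ⁿ` that is at most `t`. -/
def dyad (n : ℕ) (t : ℝ≥0) : ℝ≥0 := ⌊2 ^ n * t⌋₊ / 2 ^ n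

theorem dyad_le (n : ℕ) (t : ℝ≥0) : dyad n t ≤ t := by
  rw [dyad, div_le_iff₀ (by positivity), mul_comm]
  exact Nat.floor_le bot_le

theorem le_dyad_add (n : ℕ) (t : ℝ≥0) : t ≤ dyad n t + (1 / 2) ^ n := by
  have h := (Nat.lt_floor_add_one (2 ^ n * t)).le
  rw [dyad, one_div, inv_pow, ← one_div, ← add_div, le_div_iff₀ (by positivity), mul_comm]
  exact h

theorem tendsto_dyad (t : ℝ≥0) : Tendsto (fun n => dyad n t) atTop (𝓝 t) := by
  have h1 : Tendsto (fun n : ℕ => t - (1 / 2 : ℝ≥0) ^ n) atTop (𝓝 (t - 0)) :=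
    tendsto_const_nhds.sub (NNReal.tendsto_pow_atTop_nhds_zero_of_lt_one (NNReal.half_lt_self one_ne_zero))
  rw [tsub_zero] at h1
  exact tendsto_of_tendsto_of_tendsto_of_le_of_le h1 tendsto_const_nhds
    (fun n => tsub_le_iff_right.2 (le_dyad_add n t)) fun n => dyad_le n t

/-- Doubling a number sends its floor `m` to `2m` or `2m + 1`, so successive dyadic approximations
coincide or are neighbours on the finer grid. The bound on `k` keeps the interval within the range
where increments are controlled. -/
theorem dyad_succ_eq_or (n : ℕ) (t : ℝ≥0) :
    ∃ k : ℕ, (k : ℝ≥0) ≤ 2 ^ (n + 1) * t ∧ dyad n t = k / 2 ^ (n + 1) ∧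
      (dyad (n + 1) t = k / 2 ^ (n + 1) ∨ dyad (n + 1) t = (k + 1 : ℕ) / 2 ^ (n + 1)) := by
  have e : (2 : ℝ≥0) ^ (n + 1) * t = 2 * (2 ^ n * t) := by ring
  have h1 : (⌊2 ^ n * t⌋₊ : ℝ≥0) ≤ 2 ^ n * t := Nat.floor_le bot_le
  have h2 := Nat.lt_floor_add_one (2 ^ n * t)
  refine ⟨2 * ⌊2 ^ n * t⌋₊, ?_, ?_, ?_⟩
  · rw [e]; push_cast; gcongr
  · rw [dyad, pow_succ]; push_cast; rw [mul_comm (2 : ℝ≥0) (_ : ℝ≥0), mul_div_mul_right _ _ two_ne_zero]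
  · have h3 : 2 * ⌊2 ^ n * t⌋₊ ≤ ⌊2 ^ (n + 1) * t⌋₊ := by
      refine Nat.le_floor ?_
      rw [e]; push_cast; gcongr
    have h4 : ⌊2 ^ (n + 1) * t⌋₊ < 2 * ⌊2 ^ n * t⌋₊ + 2 := by
      rw [Nat.floor_lt bot_le, e]
      push_cast
      calc 2 * (2 ^ n * t) < 2 * (⌊2 ^ n * t⌋₊ + 1) := by gcongr
        _ = _ := by ring
    rcases (show ⌊2 ^ (n + 1) * t⌋₊ = 2 * ⌊2 ^ n * t⌋₊ ∨
      ⌊2 ^ (n + 1) * t⌋₊ = 2 * ⌊2 ^ n * t⌋₊ + 1 by omega) with h | h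
    · left; rw [dyad, h]
    · right; rw [dyad, h]

theorem dyad_eq_or_of_le (n : ℕ) {s t : ℝ≥0} (hst : s ≤ t) (h : t ≤ s + (1 / 2) ^ n) :
    ∃ k : ℕ, (k : ℝ≥0) ≤ 2 ^ n * s ∧ dyad n s = k / 2 ^ n ∧
      (dyad n t = k / 2 ^ n ∨ dyad n t = (k + 1 : ℕ) / 2 ^ n) := by
  refine ⟨⌊2 ^ n * s⌋₊, Nat.floor_le bot_le, rfl, ?_⟩
  have h1 : ⌊2 ^ n * s⌋₊ ≤ ⌊2 ^ n * t⌋₊ := Nat.floor_mono (by gcongr)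
  have h2 : ⌊2 ^ n * t⌋₊ ≤ ⌊2 ^ n * s⌋₊ + 1 := by
    rw [← Nat.floor_add_one bot_le]
    refine Nat.floor_mono ?_
    calc 2 ^ n * t ≤ 2 ^ n * (s + (1 / 2) ^ n) := by gcongr
      _ = 2 ^ n * s + 1 := by rw [mul_add, ← mul_pow]; norm_num
  rcases (show ⌊2 ^ n * t⌋₊ = ⌊2 ^ n * s⌋₊ ∨ ⌊2 ^ n * t⌋₊ = ⌊2 ^ n * s⌋₊ + 1 by omega) with h | h
  · left; rw [dyad, h]
  · right; rw [dyad, h]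

/-- A function whose increments over dyadic intervals of length `2⁻ⁿ` are at most `θⁿ` extends
continuously from the dyadic numbers. -/
theorem exists_continuous_tendsto_dyad {f : ℝ≥0 → ℝ} {θ : ℝ} (hθ0 : 0 ≤ θ) (hθ : θ < 1)
    (hf : ∀ᶠ n : ℕ in atTop, ∀ k < n * 2 ^ n,
      |f ((k + 1 : ℕ) / 2 ^ n) - f (k / 2 ^ n)| ≤ θ ^ n) :
    ∃ L : ℝ≥0 → ℝ, Continuous L ∧ ∀ t, Tendsto (fun n => f (dyad n t)) atTop (𝓝 (L t)) := by
  obtain ⟨N, hN⟩ := eventually_atTop.1 hf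
  -- The range `k < n 2ⁿ` of controlled increments covers `[0, n)`, and so every fixed time once `n`
  -- is large.
  have lt_of : ∀ {n k : ℕ} {t : ℝ≥0}, (k : ℝ≥0) ≤ 2 ^ n * t → t < n → k < n * 2 ^ n := by
    intro n k t hk ht
    have : (k : ℝ≥0) < n * 2 ^ n := hk.trans_lt (by rw [mul_comm]; gcongr)
    exact_mod_cast this
  have step : ∀ t : ℝ≥0, ∀ n : ℕ, N ≤ n → t < n →
      dist (f (dyad n t)) (f (dyad (n + 1) t)) ≤ θ ^ n := by
    intro t n hn ht
    obtain ⟨k, hk, h1, h2⟩ := dyad_succ_eq_or n t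
    have hkn : k < (n + 1) * 2 ^ (n + 1) :=
      lt_of hk (ht.trans (by exact_mod_cast Nat.lt_succ_self n))
    rcases h2 with h2 | h2
    · rw [h1, h2, dist_self]; positivity
    · rw [h1, h2, dist_comm, Real.dist_eq]
      exact (hN (n + 1) (by omega) k hkn).trans (pow_le_pow_of_le_one hθ0 hθ.le (Nat.le_succ n))
  have step' : ∀ t : ℝ≥0, ∀ n : ℕ, N ≤ n → t < n → ∀ m,
      dist (f (dyad (m + n) t)) (f (dyad (m + 1 + n) t)) ≤ θ ^ n * θ ^ m := by
    intro t n hn ht m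
    rw [← pow_add, add_comm n m, show m + 1 + n = m + n + 1 by ring]
    refine step t (m + n) (by omega) (ht.trans_le ?_)
    exact_mod_cast Nat.le_add_left n m
  have hlim : ∀ t, ∃ l, Tendsto (fun n => f (dyad n t)) atTop (𝓝 l) := by
    intro t
    obtain ⟨K, hK⟩ := exists_nat_gt t
    have hc := cauchySeq_of_le_geometric θ (θ ^ (max N K)) hθ
      (step' t (max N K) (le_max_left _ _) (hK.trans_le (by exact_mod_cast le_max_right _ _)))
    obtain ⟨l, hl⟩ := cauchySeq_tendsto_of_complete hc
    exact ⟨l, (tendsto_add_atTop_iff_nat _).1 hl⟩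
  choose L hL using hlim
  have hbd : ∀ t : ℝ≥0, ∀ n : ℕ, N ≤ n → t < n → dist (f (dyad n t)) (L t) ≤ θ ^ n / (1 - θ) := by
    intro t n hn ht
    have := dist_le_of_le_geometric_of_tendsto₀ θ (θ ^ n) hθ (step' t n hn ht)
      ((tendsto_add_atTop_iff_nat n).2 (hL t))
    simpa using this
  refine ⟨L, ?_, hL⟩
  -- Compare both points with their level-`n` approximations, which are equal or adjacent; each of
  -- the two tails is a geometric series.
  have hinc : ∀ n : ℕ, N ≤ n → ∀ s t : ℝ≥0, s ≤ t → t ≤ s + (1 / 2) ^ n → t < n →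
      dist (L s) (L t) ≤ 2 * (θ ^ n / (1 - θ)) + θ ^ n := by
    intro n hn s t hst h ht
    have h1 := hbd s n hn (hst.trans_lt ht)
    have h2 := hbd t n hn ht
    have h3 : dist (f (dyad n s)) (f (dyad n t)) ≤ θ ^ n := by
      obtain ⟨k, hk, h4, h5⟩ := dyad_eq_or_of_le n hst h
      rcases h5 with h5 | h5
      · rw [h4, h5, dist_self]; positivity
      · rw [h4, h5, dist_comm, Real.dist_eq]
        exact hN n hn k (lt_of hk (hst.trans_lt ht))
    have h4 := dist_triangle4 (L s) (f (dyad n s)) (f (dyad n t)) (L t)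
    rw [dist_comm (L s) (f _)] at h4
    linarith
  rw [Metric.continuous_iff]
  intro t ε hε
  -- The extra 1 leaves room for points `s` up to `t + 2⁻ⁿ`.
  obtain ⟨K, hK⟩ := exists_nat_gt (t + 1)
  have hlim : Tendsto (fun n => 2 * (θ ^ n / (1 - θ)) + θ ^ n) atTop (𝓝 (2 * (0 / (1 - θ)) + 0)) :=
    have h := tendsto_pow_atTop_nhds_zero_of_lt_one hθ0 hθ
    ((h.div_const _).const_mul 2).add h
  simp only [zero_div, mul_zero, add_zero] at hlim
  obtain ⟨n, hn, hnK⟩ := ((hlim.eventually_lt_const hε).and (eventually_ge_atTop (max N K))).exists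
  have hNn : N ≤ n := (le_max_left _ _).trans hnK
  have hKn : t + 1 < n := hK.trans_le (by exact_mod_cast (le_max_right _ _).trans hnK)
  refine ⟨(1 / 2) ^ n, by positivity, fun s hs => ?_⟩
  have hle : ((1 / 2 : ℝ≥0)) ^ n ≤ 1 := pow_le_one₀ bot_le (by norm_num)
  rw [NNReal.dist_eq, abs_lt] at hs
  have h1 : s ≤ t + (1 / 2) ^ n := by
    rw [← NNReal.coe_le_coe]; push_cast; linarith [hs.2]
  have h2 : t ≤ s + (1 / 2) ^ n := by
    rw [← NNReal.coe_le_coe]; push_cast; linarith [hs.1]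
  rcases le_total s t with h | h
  · exact (hinc n hNn s t h h2 ((le_self_add).trans_lt hKn)).trans_lt hn
  · rw [dist_comm]
    exact (hinc n hNn t s h h1 ((h1.trans (by gcongr)).trans_lt hKn)).trans_lt hn

end Dyadic

section ContinuousModification

/-! ### Continuous modifications of Wiener processes -/

variable {Ω : Type*} {mΩ : MeasurableSpace Ω} {P : Measure Ω}

/-- Markov's inequality for fourth moments bounds each exceptional event at level `n` by `K 4⁻ⁿ /
(9/10)⁴ⁿ`. There are `n 2ⁿ` of them, for a total of `K n (5000/6561)ⁿ`. This is summable because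
`(9/10)⁴ > 1/2`, and Borel–Cantelli applies. -/
theorem ae_eventually_dyadic_increment_le {B : ℝ≥0 → Ω → ℝ} (hm : ∀ t, AEMeasurable (B t) P)
    {K : ℝ≥0} (hK : ∀ s t, s ≤ t → ∫⁻ ω, ‖B t ω - B s ω‖ₑ ^ 4 ∂P = K * ENNReal.ofReal (t - s) ^ 2) :
    ∀ᵐ ω ∂P, ∀ᶠ n : ℕ in atTop, ∀ k < n * 2 ^ n,
      |B ((k + 1 : ℕ) / 2 ^ n) ω - B (k / 2 ^ n) ω| ≤ (9 / 10 : ℝ) ^ n := by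
  set A : ℕ → Set Ω := fun n => ⋃ k ∈ Finset.range (n * 2 ^ n),
    {ω | ENNReal.ofReal (((9 / 10 : ℝ) ^ n) ^ 4) ≤
      ‖B ((k + 1 : ℕ) / 2 ^ n) ω - B (k / 2 ^ n) ω‖ₑ ^ 4} with hA
  have hPA : ∀ n, P (A n) ≤ ENNReal.ofReal (K * ((n : ℝ) ^ 1 * (5000 / 6561 : ℝ) ^ n)) := by
    intro n
    refine (measure_biUnion_finset_le _ _).trans ?_
    have h1 : ∀ k ∈ Finset.range (n * 2 ^ n), P {ω | ENNReal.ofReal (((9 / 10 : ℝ) ^ n) ^ 4) ≤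
        ‖B ((k + 1 : ℕ) / 2 ^ n) ω - B (k / 2 ^ n) ω‖ₑ ^ 4} ≤
        ENNReal.ofReal (K * ((1 / 2 : ℝ) ^ n) ^ 2 / ((9 / 10 : ℝ) ^ n) ^ 4) := by
      intro k _
      have hle : (k / 2 ^ n : ℝ≥0) ≤ (k + 1 : ℕ) / 2 ^ n := by gcongr; exact k.le_succ
      have e : (((k + 1 : ℕ) / 2 ^ n : ℝ≥0) : ℝ) - (k / 2 ^ n : ℝ≥0) = (1 / 2 : ℝ) ^ n := by
        push_cast
        rw [← sub_div, one_div_pow]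
        congr 1
        ring
      have h2 := mul_meas_ge_le_lintegral₀ (μ := P)
        (f := fun ω => ‖B ((k + 1 : ℕ) / 2 ^ n) ω - B (k / 2 ^ n) ω‖ₑ ^ 4)
        (((hm _).sub (hm _)).enorm.pow_const 4) (ENNReal.ofReal (((9 / 10 : ℝ) ^ n) ^ 4))
      rw [hK _ _ hle, e] at h2
      rw [ENNReal.ofReal_div_of_pos (by positivity), ENNReal.le_div_iff_mul_le (.inl (by simp; positivity))
        (.inl ENNReal.ofReal_ne_top),
        ENNReal.ofReal_mul (by positivity), ENNReal.ofReal_coe_nnreal,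
        ENNReal.ofReal_pow (p := (1 / 2 : ℝ) ^ n) (by positivity), mul_comm]
      exact h2
    refine (Finset.sum_le_sum h1).trans ?_
    rw [Finset.sum_const, Finset.card_range, nsmul_eq_mul, ← ENNReal.ofReal_natCast,
      ← ENNReal.ofReal_mul (by positivity)]
    refine ENNReal.ofReal_le_ofReal (le_of_eq ?_)
    have e1 : ((1 / 2 : ℝ) ^ n) ^ 2 = (1 / 4) ^ n := by rw [pow_right_comm]; norm_num
    have e2 : ((9 / 10 : ℝ) ^ n) ^ 4 = (6561 / 10000) ^ n := by rw [pow_right_comm]; norm_num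
    have e3 : (5000 / 6561 : ℝ) ^ n = 2 ^ n * (1 / 4) ^ n / (6561 / 10000) ^ n := by
      rw [← mul_pow, ← div_pow]; norm_num
    rw [e1, e2, e3, Nat.cast_mul, Nat.cast_pow, Nat.cast_ofNat, pow_one]
    generalize (1 / 4 : ℝ) ^ n = a, (6561 / 10000 : ℝ) ^ n = b, (2 : ℝ) ^ n = c
    ring
  have hsum : ∑' n, P (A n) ≠ ∞ := by
    have hs : Summable fun n : ℕ => (K : ℝ) * ((n : ℝ) ^ 1 * (5000 / 6561 : ℝ) ^ n) :=
      have hr : ‖(5000 / 6561 : ℝ)‖ < 1 := by rw [Real.norm_of_nonneg] <;> norm_num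
      (summable_pow_mul_geometric_of_norm_lt_one 1 hr).mul_left (K : ℝ)
    exact ne_top_of_le_ne_top hs.tsum_ofReal_ne_top (ENNReal.tsum_le_tsum hPA)
  filter_upwards [ae_eventually_notMem hsum] with ω hω
  filter_upwards [hω] with n hn k hk
  by_contra! hlt
  refine hn (Set.mem_biUnion (Finset.mem_coe.2 (Finset.mem_range.2 hk)) ?_)
  rw [Set.mem_ofPred_eq, ENNReal.ofReal_pow (by positivity), Real.enorm_eq_ofReal_abs]
  gcongr

/-- A process whose increments have fourth moments of order `(t - s)²` has a modification with
almost surely continuous paths. -/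
theorem exists_continuous_modification [IsFiniteMeasure P] {B : ℝ≥0 → Ω → ℝ}
    (hm : ∀ t, AEMeasurable (B t) P) {K : ℝ≥0}
    (hK : ∀ s t, s ≤ t → ∫⁻ ω, ‖B t ω - B s ω‖ₑ ^ 4 ∂P = K * ENNReal.ofReal (t - s) ^ 2) :
    ∃ X : ℝ≥0 → Ω → ℝ, (∀ᵐ ω ∂P, Continuous fun t => X t ω) ∧ ∀ t, X t =ᵐ[P] B t := by
  have hae : ∀ᵐ ω ∂P, ∃ L : ℝ≥0 → ℝ, Continuous L ∧
      ∀ t, Tendsto (fun n => B (dyad n t) ω) atTop (𝓝 (L t)) := by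
    filter_upwards [ae_eventually_dyadic_increment_le hm hK] with ω hω
    exact exists_continuous_tendsto_dyad (f := fun t => B t ω) (by norm_num) (by norm_num) hω
  refine ⟨fun t ω => limUnder atTop fun n => B (dyad n t) ω, ?_, fun t => ?_⟩
  · filter_upwards [hae] with ω ⟨L, hL, h⟩
    rwa [show (fun t => limUnder atTop fun n => B (dyad n t) ω) = L from
      funext fun t => (h t).limUnder_eq]
  -- Along the dyadic times `B` converges almost surely to the new process and in `L⁴` to `B t`;
  -- limits in measure are unique.
  · refine tendstoInMeasure_ae_unique (f := fun n => B (dyad n t)) (u := atTop)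
      (tendstoInMeasure_of_tendsto_ae (fun n => (hm _).aestronglyMeasurable) ?_)
      (tendstoInMeasure_of_tendsto_eLpNorm (p := 4) (by simp)
        (fun n => (hm _).aestronglyMeasurable) (hm t).aestronglyMeasurable ?_)
    · filter_upwards [hae] with ω ⟨L, hL, h⟩
      rw [(h t).limUnder_eq]
      exact h t
    · have e : ∀ n, eLpNorm (B (dyad n t) - B t) 4 P =
          (K * ENNReal.ofReal (t - dyad n t) ^ 2) ^ (1 / 4 : ℝ) := by
        intro n
        rw [eLpNorm_sub_comm, eLpNorm_eq_lintegral_rpow_enorm_toReal (by simp) (by simp),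
          ← hK _ _ (dyad_le n t)]
        simp
      simp_rw [e]
      have h0 : Tendsto (fun n => (t : ℝ) - dyad n t) atTop (𝓝 0) := by
        have := (NNReal.continuous_coe.tendsto t).comp (tendsto_dyad t)
        simpa using (tendsto_const_nhds (x := (t : ℝ))).sub this
      have h1 : Tendsto (fun n => (K : ℝ≥0∞) * ENNReal.ofReal (t - dyad n t) ^ 2) atTop (𝓝 0) := by
        have := (((ENNReal.continuous_pow 2).comp ENNReal.continuous_ofReal).tendsto 0).comp h0
        have h2 := ENNReal.Tendsto.const_mul (a := (K : ℝ≥0∞)) this (.inr ENNReal.coe_ne_top)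
        simpa [Function.comp_def] using! h2
      have h3 := ((ENNReal.continuous_rpow_const (y := (1 / 4 : ℝ))).tendsto 0).comp h1
      rwa [ENNReal.zero_rpow_of_pos (by norm_num)] at h3

end ContinuousModification

section ContinuousVersion

/-! ### Continuous versions of square-integrable martingales -/

variable {Ω : Type*} {mΩ : MeasurableSpace Ω} {F : Filtration ℝ≥0 mΩ} {P : Measure Ω}

/-- The process `X` has almost surely continuous paths on `[0, T]` and is a version of the
martingale `E[x | F t]`. -/
structure IsContinuousVersion (F : Filtration ℝ≥0 mΩ) (P : Measure Ω) (T : ℝ≥0) (x : Lp ℝ 2 P)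
    (X : ℝ≥0 → Ω → ℝ) : Prop where
  continuousOn : ∀ᵐ ω ∂P, ContinuousOn (fun t => X t ω) (Set.Icc 0 T)
  ae_eq : ∀ t ≤ T, X t =ᵐ[P] condExpLp P (F.le t) x

theorem IsContinuousVersion.add {T : ℝ≥0} {x y : Lp ℝ 2 P} {X Y : ℝ≥0 → Ω → ℝ}
    (hX : IsContinuousVersion F P T x X) (hY : IsContinuousVersion F P T y Y) :
    IsContinuousVersion F P T (x + y) (X + Y) where
  continuousOn := by
    filter_upwards [hX.continuousOn, hY.continuousOn] with ω h1 h2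
    exact h1.add h2
  ae_eq t ht := by
    rw [map_add]
    filter_upwards [hX.ae_eq t ht, hY.ae_eq t ht, Lp.coeFn_add (condExpLp P (F.le t) x)
      (condExpLp P (F.le t) y)] with ω h1 h2 h3
    rw [h3, Pi.add_apply, Pi.add_apply, Pi.add_apply, h1, h2]

theorem IsContinuousVersion.sub {T : ℝ≥0} {x y : Lp ℝ 2 P} {X Y : ℝ≥0 → Ω → ℝ}
    (hX : IsContinuousVersion F P T x X) (hY : IsContinuousVersion F P T y Y) :
    IsContinuousVersion F P T (x - y) (X - Y) where
  continuousOn := by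
    filter_upwards [hX.continuousOn, hY.continuousOn] with ω h1 h2
    exact h1.sub h2
  ae_eq t ht := by
    rw [map_sub]
    filter_upwards [hX.ae_eq t ht, hY.ae_eq t ht, Lp.coeFn_sub (condExpLp P (F.le t) x)
      (condExpLp P (F.le t) y)] with ω h1 h2 h3
    rw [h3, Pi.sub_apply, Pi.sub_apply, Pi.sub_apply, h1, h2]

theorem isContinuousVersion_zero {T : ℝ≥0} : IsContinuousVersion F P T 0 0 where
  continuousOn := .of_forall fun _ => continuousOn_const
  ae_eq t _ := by
    rw [map_zero]
    exact (Lp.coeFn_zero ℝ 2 P).symm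

variable [IsProbabilityMeasure P]

/-- Doob's maximal inequality along an increasing sequence of times. -/
theorem mul_measure_exists_lt_condExp_le (x : Lp ℝ 2 P) {q : ℕ → ℝ≥0} (hq : Monotone q) (n : ℕ)
    (ε : ℝ≥0) :
    ε * P {ω | ∃ k ≤ n, (ε : ℝ) < |(P[x | F (q k)]) ω|} ≤ ‖x‖ₑ := by
  set G : Filtration ℕ mΩ := ⟨fun k => F (q k), fun i j h => F.mono (hq h), fun i => F.le (q i)⟩
    with hG
  have hM : Martingale (fun k => P[x | G k]) G P := martingale_condExp x G P
  -- The absolute value of a martingale, as the maximum of it and its negative, is a submartingale.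
  -- The weak `L¹` maximal inequality suffices, since the `L¹` norm is at most the `L²` norm under a
  -- probability measure.
  set f : ℕ → Ω → ℝ := (fun k => P[x | G k]) ⊔ -(fun k => P[x | G k]) with hf
  have hfabs : ∀ k ω, f k ω = |(P[x | F (q k)]) ω| := fun k ω => rfl
  have hsub : Submartingale f G P := hM.submartingale.sup hM.neg.submartingale
  have hnn : 0 ≤ f := fun k ω => by rw [hfabs]; exact abs_nonneg _
  have h1 := maximal_ineq hsub hnn (ε := ε) n
  refine (mul_le_mul_right (measure_mono ?_) _).trans (h1.trans ?_)
  · rintro ω ⟨k, hk, hlt⟩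
    refine hlt.le.trans ?_
    rw [← hfabs]
    exact Finset.le_sup' (fun k => f k ω) (Finset.mem_range.2 (Nat.lt_succ_of_le hk))
  · have h2 : ∫ ω in {ω | (ε : ℝ) ≤ (Finset.range (n + 1)).sup' Finset.nonempty_range_add_one
        fun k => f k ω}, f n ω ∂P ≤ ∫ ω, |(P[x | F (q n)]) ω| ∂P :=
      setIntegral_le_integral (hsub.integrable n) (.of_forall fun ω => hnn n ω)
    have h3 := h2.trans (integral_abs_condExp_le (m := F (q n)) (μ := P) x)
    have hi := (Lp.memLp x).integrable one_le_two
    refine (ENNReal.ofReal_le_ofReal h3).trans ?_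
    rw [Lp.enorm_def]
    refine le_trans (le_of_eq ?_)
      (eLpNorm_le_eLpNorm_of_exponent_le one_le_two (Lp.aestronglyMeasurable x))
    rw [eLpNorm_one_eq_lintegral_enorm]
    exact ofReal_integral_norm_eq_lintegral_enorm hi

/-- Doob's maximal inequality in continuous time. -/
theorem IsContinuousVersion.mul_measure_exists_lt_le {T : ℝ≥0} {x : Lp ℝ 2 P}
    {X : ℝ≥0 → Ω → ℝ} (hX : IsContinuousVersion F P T x X) (ε : ℝ≥0) :
    ε * P {ω | ∃ t ≤ T, (ε : ℝ) < |X t ω|} ≤ ‖x‖ₑ := by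
  obtain ⟨K, hK⟩ := exists_nat_ge T
  set q : ℕ → ℕ → ℝ≥0 := fun n k => min (k / 2 ^ n) T with hq
  have hqT : ∀ n k, q n k ≤ T := fun n k => min_le_right _ _
  -- The dyadic grids, capped at `T`, are nested. A strict inequality at some `t` persists at nearby
  -- grid points by path continuity, so these events increase to the full one up to a null set.
  set A : ℕ → Set Ω := fun n => {ω | ∃ k ≤ K * 2 ^ n, (ε : ℝ) < |X (q n k) ω|} with hA
  have hmono : Monotone A := by
    refine monotone_nat_of_le_succ fun n ω ⟨k, hk, h⟩ => ⟨2 * k, ?_, ?_⟩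
    · calc 2 * k ≤ 2 * (K * 2 ^ n) := by gcongr
        _ = K * 2 ^ (n + 1) := by ring
    · have : q (n + 1) (2 * k) = q n k := by
        simp only [hq]
        congr 1
        rw [pow_succ', Nat.cast_mul, Nat.cast_ofNat, mul_div_mul_left _ _ two_ne_zero]
      rwa [this]
  have hle : P {ω | ∃ t ≤ T, (ε : ℝ) < |X t ω|} ≤ P (⋃ n, A n) := by
    refine measure_mono_ae ?_
    filter_upwards [hX.continuousOn] with ω hω ⟨t, ht, hlt⟩
    have h1 : Tendsto (fun n => |X (dyad n t) ω|) atTop (𝓝 |X t ω|) := by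
      refine ((hω t ⟨bot_le, ht⟩).tendsto.comp (tendsto_nhdsWithin_iff.2
        ⟨tendsto_dyad t, .of_forall fun n => ⟨bot_le, (dyad_le n t).trans ht⟩⟩)).abs
    obtain ⟨n, hn⟩ := (h1.eventually_const_lt hlt).exists
    refine Set.mem_iUnion.2 ⟨n, ⌊2 ^ n * t⌋₊, ?_, ?_⟩
    · have : (⌊2 ^ n * t⌋₊ : ℝ≥0) ≤ K * 2 ^ n := (Nat.floor_le bot_le).trans (by
        rw [mul_comm]; gcongr; exact ht.trans hK)
      exact_mod_cast this
    · have : q n ⌊2 ^ n * t⌋₊ = dyad n t := min_eq_left ((dyad_le n t).trans ht)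
      rwa [this]
  refine (mul_le_mul_right hle _).trans ?_
  rw [hmono.measure_iUnion, ENNReal.mul_iSup]
  refine iSup_le fun n => ?_
  refine le_trans (mul_le_mul_right (measure_mono_ae ?_) _)
    (mul_measure_exists_lt_condExp_le (F := F) x (q := q n) ?_ (K * 2 ^ n) ε)
  · have hall : ∀ᵐ ω ∂P, ∀ k, X (q n k) ω = (P[x | F (q n k)]) ω :=
      ae_all_iff.2 fun k => (hX.ae_eq _ (hqT n k)).trans (condExpLp_ae_eq _ _)
    filter_upwards [hall] with ω hω ⟨k, hk, h⟩
    exact ⟨k, hk, by rwa [← hω k]⟩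
  · intro i j hij
    exact min_le_min_right _ (by gcongr)

/-- If `‖xⱼ₊₁ - xⱼ‖ ≤ 2 · 4⁻ʲ`, then the continuous versions of the
martingales `E[xⱼ | F t]` converge almost surely uniformly. -/
theorem IsContinuousVersion.ae_eventually_dist_le {T : ℝ≥0} {z : ℕ → Lp ℝ 2 P}
    {X : ℕ → ℝ≥0 → Ω → ℝ} (hX : ∀ j, IsContinuousVersion F P T (z j) (X j))
    (hz : ∀ j, ‖z (j + 1) - z j‖ ≤ 2 * (1 / 4) ^ j) :
    ∀ᵐ ω ∂P, ∀ᶠ j in atTop, ∀ t ≤ T, dist (X j t ω) (X (j + 1) t ω) ≤ (1 / 2) ^ j := by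
  have h1 : ∀ j, P {ω | ∃ t ≤ T, (((1 / 2) ^ j : ℝ≥0) : ℝ) < |(X (j + 1) - X j) t ω|} ≤
      ENNReal.ofReal (2 * (1 / 2) ^ j) := by
    intro j
    have h2 := ((hX (j + 1)).sub (hX j)).mul_measure_exists_lt_le ((1 / 2) ^ j)
    have h3 : ‖z (j + 1) - z j‖ₑ ≤ ENNReal.ofReal (2 * (1 / 4) ^ j) := by
      rw [← ofReal_norm]
      exact ENNReal.ofReal_le_ofReal (hz j)
    have h4 := h2.trans h3
    -- Dividing by the threshold `2⁻ʲ` in the maximal inequality leaves the summable bound `2 ·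
    -- 2⁻ʲ`.
    have e : (2 * (1 / 4) ^ j : ℝ) = (1 / 2) ^ j * (2 * (1 / 2) ^ j) := by
      rw [mul_left_comm, ← mul_pow]; norm_num
    have e' : (((1 / 2) ^ j : ℝ≥0) : ℝ≥0∞) = ENNReal.ofReal ((1 / 2) ^ j) := by
      rw [← ENNReal.ofReal_coe_nnreal]; push_cast; rfl
    rw [e, ENNReal.ofReal_mul (by positivity), e'] at h4
    rwa [ENNReal.mul_le_mul_iff_right (by simp) ENNReal.ofReal_ne_top] at h4
  have hsum : ∑' j, P {ω | ∃ t ≤ T, (((1 / 2) ^ j : ℝ≥0) : ℝ) < |(X (j + 1) - X j) t ω|} ≠ ∞ := by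
    have hs : Summable fun j : ℕ => 2 * (1 / 2 : ℝ) ^ j := summable_geometric_two.mul_left 2
    exact ne_top_of_le_ne_top hs.tsum_ofReal_ne_top (ENNReal.tsum_le_tsum h1)
  filter_upwards [ae_eventually_notMem hsum] with ω hω
  filter_upwards [hω] with j hj t ht
  by_contra! hlt
  refine hj ⟨t, ht, ?_⟩
  rw [dist_comm, Real.dist_eq] at hlt
  push_cast
  exact hlt

/-- The elements of `L²` whose martingales have continuous versions. -/
def continuousVersionSet (F : Filtration ℝ≥0 mΩ) (P : Measure Ω) (T : ℝ≥0) : Set (Lp ℝ 2 P) :=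
  {x | ∃ X, IsContinuousVersion F P T x X}

/-- Along a subsequence converging at rate `4⁻ʲ`, the continuous versions converge almost surely
uniformly on `[0, T]`, so the limit paths are continuous. The limit is a version of the right
martingale because conditional expectation is continuous on `L²`. -/
theorem isClosed_continuousVersionSet (T : ℝ≥0) : IsClosed (continuousVersionSet F P T) := by
  refine IsSeqClosed.isClosed fun y x hy hx => ?_
  have hsub : ∀ j : ℕ, ∃ n, dist (y n) x < (1 / 4) ^ j := fun j =>
    ((Metric.tendsto_nhds.1 hx) _ (by positivity)).exists
  choose n hn using hsub
  choose Y hY using hy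
  set z : ℕ → Lp ℝ 2 P := fun j => y (n j) with hz
  have hX : ∀ j, IsContinuousVersion F P T (z j) (Y (n j)) := fun j => hY (n j)
  have hzx : Tendsto z atTop (𝓝 x) := by
    rw [tendsto_iff_dist_tendsto_zero]
    exact squeeze_zero (fun _ => dist_nonneg) (fun j => (hn j).le)
      (tendsto_pow_atTop_nhds_zero_of_lt_one (by norm_num) (by norm_num))
  have hz2 : ∀ j, ‖z (j + 1) - z j‖ ≤ 2 * (1 / 4) ^ j := by
    intro j
    rw [← dist_eq_norm]
    have h1 := dist_triangle_right (z (j + 1)) (z j) x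
    have h2 : ((1 / 4 : ℝ)) ^ (j + 1) ≤ (1 / 4) ^ j :=
      pow_le_pow_of_le_one (by norm_num) (by norm_num) j.le_succ
    linarith [hn j, hn (j + 1)]
  have hae : ∀ᵐ ω ∂P, ∃ L : ℝ≥0 → ℝ, ContinuousOn L (Set.Icc 0 T) ∧
      ∀ t ≤ T, Tendsto (fun j => Y (n j) t ω) atTop (𝓝 (L t)) := by
    filter_upwards [IsContinuousVersion.ae_eventually_dist_le hX hz2,
      ae_all_iff.2 fun j => (hX j).continuousOn] with ω h1 h2
    obtain ⟨J, hJ⟩ := eventually_atTop.1 h1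
    have hstep : ∀ j, J ≤ j → ∀ t ≤ T, ∀ m,
        dist (Y (n (m + j)) t ω) (Y (n (m + 1 + j)) t ω) ≤ (1 / 2) ^ j * (1 / 2) ^ m := by
      intro j hj t ht m
      rw [← pow_add, add_comm j m, show m + 1 + j = m + j + 1 by ring]
      exact hJ (m + j) (by omega) t ht
    have hlim : ∀ t, ∃ l, t ≤ T → Tendsto (fun j => Y (n j) t ω) atTop (𝓝 l) := by
      intro t
      by_cases ht : t ≤ T
      · obtain ⟨l, hl⟩ := cauchySeq_tendsto_of_complete
          (cauchySeq_of_le_geometric (1 / 2) ((1 / 2) ^ J) (by norm_num) (hstep J le_rfl t ht))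
        exact ⟨l, fun _ => (tendsto_add_atTop_iff_nat J).1 hl⟩
      · exact ⟨0, fun h => absurd h ht⟩
    choose L hL using hlim
    refine ⟨L, ?_, hL⟩
    have hunif : TendstoUniformlyOn (fun j t => Y (n j) t ω) L atTop (Set.Icc 0 T) := by
      rw [Metric.tendstoUniformlyOn_iff]
      intro ε hε
      have h3 : Tendsto (fun j : ℕ => (1 / 2 : ℝ) ^ j / (1 - 1 / 2)) atTop
          (𝓝 (0 / (1 - 1 / 2))) :=
        (tendsto_pow_atTop_nhds_zero_of_lt_one (by norm_num) (by norm_num)).div_const _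
      rw [zero_div] at h3
      filter_upwards [h3.eventually_lt_const hε, eventually_ge_atTop J] with j hj hJj t ht
      have := dist_le_of_le_geometric_of_tendsto₀ (1 / 2) ((1 / 2) ^ j) (by norm_num)
        (hstep j hJj t ht.2) ((tendsto_add_atTop_iff_nat j).2 (hL t ht.2))
      rw [zero_add] at this
      rw [dist_comm]
      exact this.trans_lt hj
    exact hunif.continuousOn (.of_forall fun j => h2 j)
  refine ⟨fun t ω => limUnder atTop fun j => Y (n j) t ω, ?_, fun t ht => ?_⟩
  · filter_upwards [hae] with ω ⟨L, hL, h⟩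
    exact hL.congr fun t ht => (h t ht.2).limUnder_eq
  · refine tendstoInMeasure_ae_unique
      (f := fun j => (condExpLp P (F.le t) (z j) : Ω → ℝ)) (u := atTop)
      (tendstoInMeasure_of_tendsto_ae (fun j => Lp.aestronglyMeasurable _) ?_)
      (tendstoInMeasure_of_tendsto_Lp
        (((condExpLp P (F.le t)).continuous.tendsto x).comp hzx))
    filter_upwards [hae, ae_all_iff.2 fun j => (hX j).ae_eq t ht] with ω ⟨L, hL, h⟩ h2
    rw [(h t ht).limUnder_eq]
    exact (h t ht).congr h2

/-- A martingale with a continuous version has a version that is adapted and has almost surely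
continuous paths, even if the filtration is not complete. -/
theorem IsContinuousVersion.exists_isContSqMartingale {T : ℝ≥0} {x : Lp ℝ 2 P} {X : ℝ≥0 → Ω → ℝ}
    (hX : IsContinuousVersion F P T x X) :
    ∃ M : Set.Icc 0 T → Ω → ℝ, IsContSqMartingale F P T M ∧
      ∀ t : Set.Icc 0 T, M t =ᵐ[P] condExpLp P (F.le t) x := by
  -- As `dyad n t ≤ t`, every function in this sequence is exactly `F t`-measurable, and so is the
  -- limit. Only countably many dyadic times occur, so one null set suffices for agreement with `X`
  -- at all times.
  set M : Set.Icc 0 T → Ω → ℝ :=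
    fun t ω => limUnder atTop fun n => (P[x | F (dyad n (t : ℝ≥0))]) ω with hM
  have hae : ∀ᵐ ω ∂P, ContinuousOn (fun t => X t ω) (Set.Icc 0 T) ∧
      ∀ t : Set.Icc 0 T, M t ω = X t ω := by
    have hall : ∀ᵐ ω ∂P, ∀ n k : ℕ, (k / 2 ^ n : ℝ≥0) ≤ T →
        X (k / 2 ^ n) ω = (P[x | F (k / 2 ^ n)]) ω :=
      ae_all_iff.2 fun n => ae_all_iff.2 fun k => by
        by_cases h : (k / 2 ^ n : ℝ≥0) ≤ T
        · filter_upwards [(hX.ae_eq _ h).trans (condExpLp_ae_eq _ _)] with ω hω _ using hω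
        · exact .of_forall fun ω h' => absurd h' h
    filter_upwards [hX.continuousOn, hall] with ω hω h
    refine ⟨hω, fun t => Tendsto.limUnder_eq ?_⟩
    have h1 : Tendsto (fun n => X (dyad n t) ω) atTop (𝓝 (X t ω)) :=
      (hω t t.2).tendsto.comp (tendsto_nhdsWithin_iff.2
        ⟨tendsto_dyad t, .of_forall fun n => ⟨bot_le, (dyad_le n t).trans t.2.2⟩⟩)
    exact h1.congr fun n => h n _ ((dyad_le n t).trans t.2.2)
  have hMx : ∀ t : Set.Icc 0 T, M t =ᵐ[P] condExpLp P (F.le t) x := by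
    intro t
    filter_upwards [hae, hX.ae_eq t t.2.2] with ω h1 h2
    rw [h1.2 t, h2]
  have hMc : ∀ t : Set.Icc 0 T, M t =ᵐ[P] P[x | F t] := fun t =>
    (hMx t).trans (condExpLp_ae_eq _ _)
  refine ⟨M, ⟨⟨fun t => ?_, fun s t hst => ?_⟩, fun t => ?_, ?_⟩, hMx⟩
  · exact @StronglyMeasurable.limUnder _ _ _ (F t) _ _ _ _ _ _ _ fun n =>
      stronglyMeasurable_condExp.mono (F.mono (dyad_le n t))
  · refine (condExp_congr_ae (hMc t)).trans ?_
    exact (condExp_condExp_of_le (F.mono hst) (F.le t)).trans (hMc s).symm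
  · exact (memLp_congr_ae (hMx t)).2 (Lp.memLp _)
  · filter_upwards [hae] with ω ⟨h1, h2⟩
    simp_rw [h2]
    exact continuousOn_iff_continuous_domRestrict.1 h1

/-- Elementary integrals with respect to a process with a continuous modification have continuous
versions. -/
theorem SimpleAdapted.mem_continuousVersionSet {B X : ℝ≥0 → Ω → ℝ}
    (hB : HasOrthogonalIncrements F P B) (hc : ∀ᵐ ω ∂P, Continuous fun t => X t ω)
    (hX : ∀ t, X t =ᵐ[P] B t) (φ : SimpleAdapted F) (T : ℝ≥0) :
    (φ.memLp_integral hB T).toLp _ ∈ continuousVersionSet F P T := by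
  refine ⟨φ.integral X, ?_, fun t ht => ?_⟩
  · filter_upwards [hc] with ω hω
    refine Continuous.continuousOn ?_
    unfold integral
    refine continuous_finsetSum _ fun j _ => continuous_const.mul (Continuous.sub ?_ ?_)
    · exact hω.comp (continuous_const.min continuous_id)
    · exact hω.comp (continuous_const.min continuous_id)
  · rw [φ.condExpLp_integral hB ht]
    refine Filter.EventuallyEq.trans ?_ (MemLp.coeFn_toLp _).symm
    have h1 := ae_all_iff.2 fun j => hX (min (φ.right j) t)
    have h2 := ae_all_iff.2 fun j => hX (min (φ.left j) t)
    filter_upwards [h1, h2] with ω h3 h4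
    simp only [integral, h3, h4]

theorem IsItoIntegral.mem_continuousVersionSet {B X f : ℝ≥0 → Ω → ℝ}
    (hB : HasOrthogonalIncrements F P B) (hc : ∀ᵐ ω ∂P, Continuous fun t => X t ω)
    (hX : ∀ t, X t =ᵐ[P] B t) {T : ℝ≥0}
    (hf : MemLp (fun p : ℝ≥0 × Ω => f p.1 p.2) 2 (timeProd P T)) {I : Lp ℝ 2 P}
    (hI : IsItoIntegral F P B f T I) : I ∈ continuousVersionSet F P T := by
  obtain ⟨φ, -, h⟩ := (isItoIntegral_iff hB hf).1 hI
  exact (isClosed_continuousVersionSet T).mem_of_tendsto h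
    (.of_forall fun n => (φ n).mem_continuousVersionSet hB hc hX T)

theorem tsum_mem_continuousVersionSet {ι : Type*} {T : ℝ≥0} {x : ι → Lp ℝ 2 P}
    (hx : ∀ k, x k ∈ continuousVersionSet F P T) (hs : Summable x) :
    ∑' k, x k ∈ continuousVersionSet F P T := by
  classical
  refine (isClosed_continuousVersionSet T).mem_of_tendsto hs.hasSum (.of_forall fun s => ?_)
  induction s using Finset.induction_on with
  | empty => exact ⟨0, isContinuousVersion_zero⟩
  | insert a s ha ih =>
    rw [Finset.sum_insert ha]
    obtain ⟨X, hX⟩ := hx a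
    obtain ⟨Y, hY⟩ := ih
    exact ⟨X + Y, hX.add hY⟩

end ContinuousVersion

section Hilbert

variable {ι E : Type*} [NormedAddCommGroup E] [InnerProductSpace ℝ E]

/-! ### Orthogonal series -/

theorem summable_of_pairwise_inner_eq_zero [CompleteSpace E] {x : ι → E}
    (hx : Pairwise fun i j => inner ℝ (x i) (x j) = 0) (hs : Summable fun i => ‖x i‖ ^ 2) :
    Summable x := by
  have hV : OrthogonalFamily ℝ (fun i => (ℝ ∙ x i : Submodule ℝ E))
      fun i => (ℝ ∙ x i : Submodule ℝ E).subtypeₗᵢ := by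
    refine OrthogonalFamily.of_pairwise fun i j hij => ?_
    rw [Function.onFun, Submodule.isOrtho_span]
    rintro _ rfl _ rfl
    exact hx hij
  exact (hV.summable_iff_norm_sq_summable
    fun i => ⟨x i, Submodule.mem_span_singleton_self _⟩).2 hs

theorem hasSum_norm_sq_of_pairwise_inner_eq_zero {x : ι → E}
    (hx : Pairwise fun i j => inner ℝ (x i) (x j) = 0) (hs : Summable x) :
    HasSum (fun i => ‖x i‖ ^ 2) (‖∑' i, x i‖ ^ 2) := by
  have h1 : ∀ i, inner ℝ (∑' j, x j) (x i) = ‖x i‖ ^ 2 := by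
    intro i
    rw [real_inner_comm]
    have h2 := (innerSL ℝ (x i)).hasSum hs.hasSum
    refine (h2.unique ?_)
    rw [← real_inner_self_eq_norm_sq]
    exact hasSum_single i fun j hj => hx hj.symm
  have h3 := (innerSL ℝ (∑' j, x j)).hasSum hs.hasSum
  rw [← real_inner_self_eq_norm_sq]
  exact h3.congr_fun fun i => (h1 i).symm

/-- Parseval's identity in extended nonnegative form, so that sum and integrals can be exchanged by
Tonelli. -/
theorem HilbertBasis.tsum_enorm_inner_sq (e : HilbertBasis ι ℝ E) (x : E) :
    ∑' k, ‖inner ℝ (e k) x‖ₑ ^ 2 = ‖x‖ₑ ^ 2 := by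
  have h := e.hasSum_inner_mul_inner x x
  have h1 : ∀ k, ‖inner ℝ (e k) x‖ₑ ^ 2 = ENNReal.ofReal (inner ℝ x (e k) * inner ℝ (e k) x) := by
    intro k
    rw [← ofReal_norm, ← ENNReal.ofReal_pow (norm_nonneg _), real_inner_comm, Real.norm_eq_abs,
      sq_abs, sq]
  simp_rw [h1]
  rw [← ENNReal.ofReal_tsum_of_nonneg (fun k => ?_) h.summable, h.tsum_eq,
    real_inner_self_eq_norm_sq, ENNReal.ofReal_pow (norm_nonneg _), ofReal_norm]
  rw [real_inner_comm]
  exact mul_self_nonneg _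

end Hilbert

/-! ### Factorization of the covariance operator through its Hilbert space -/

namespace PosSymmOperator

variable {U : Type*} [NormedAddCommGroup U] [NormedSpace ℝ U] [CompleteSpace U]
  (Q : PosSymmOperator U)

/-- Both elements have the same inner product with every vector of the dense range of `Q`, by the
definition of the form. -/
theorem iQAdj_eq_coe (u : StrongDual ℝ U) : Q.iQAdj u = (Q.toRange u : Q.RKHS) := by
  refine ext_inner_left ℝ fun h => ?_
  rw [inner_iQAdj]
  induction h using UniformSpace.Completion.induction_on with
  | hp => exact isClosed_eq (by fun_prop) (by fun_prop)
  | ih x => rw [iQ_coe, UniformSpace.Completion.inner_coe, inner_toRange]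

/-- The factorization `Q = i_Q i_Q*`. -/
theorem iQ_iQAdj (u : StrongDual ℝ U) : Q.iQ (Q.iQAdj u) = Q.op u := by
  rw [iQAdj_eq_coe, iQ_coe, inclₗ_toRange]

end PosSymmOperator

section Main

variable {U : Type*} [NormedAddCommGroup U] [NormedSpace ℝ U]
  {V : Type*} [NormedAddCommGroup V] [NormedSpace ℝ V]
  {Ω : Type*} {mΩ : MeasurableSpace Ω} {P : Measure Ω} {F : Filtration ℝ≥0 mΩ}

/-! ### The integrators `W(·)u*` -/

theorem IsWeaklyCylWiener.hasOrthogonalIncrements {W : ℝ≥0 → CylRV U P}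
    (hW : IsWeaklyCylWiener F P W) (u : StrongDual ℝ U) :
    HasOrthogonalIncrements F P (fun t ω => W t u ω) :=
  (hW.wiener 1 fun _ => u).hasOrthogonalIncrements 0

/-- Mixed increments are controlled because the pair is jointly a two-dimensional Wiener process. -/
theorem IsWeaklyCylWiener.hasCovariation [IsProbabilityMeasure P] {W : ℝ≥0 → CylRV U P}
    (hW : IsWeaklyCylWiener F P W) (u u' : StrongDual ℝ U) :
    HasCovariation F P cov[W 1 u, W 1 u'; P] (fun t ω => W t u ω) (fun t ω => W t u' ω) :=
  (hW.wiener 2 ![u, u']).hasCovariation 0 1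

theorem IsWeaklyCylWiener.exists_continuous_modification [IsProbabilityMeasure P]
    {W : ℝ≥0 → CylRV U P} (hW : IsWeaklyCylWiener F P W) (u : StrongDual ℝ U) :
    ∃ X : ℝ≥0 → Ω → ℝ, (∀ᵐ ω ∂P, Continuous fun t => X t ω) ∧ ∀ t, X t =ᵐ[P] W t u := by
  obtain ⟨K, hK⟩ := (hW.wiener 1 fun _ => u).exists_lintegral_increment_pow_four 0
  exact _root_.exists_continuous_modification (B := fun t ω => W t u ω)
    (fun t => (AEEqFun.aestronglyMeasurable (W t u)).aemeasurable) hK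

/-- The source of all orthogonality: for `i_Q*u_k* = e_k`, the covariances at time 1 are the Gram
matrix of an orthonormal basis. -/
theorem covariance_eq_inner [CompleteSpace U] {X : CylRV U P} {Q : PosSymmOperator U}
    (hQ : HasCovarianceOperator P X Q.op) (u u' : StrongDual ℝ U) :
    cov[X u, X u'; P] = inner ℝ (Q.iQAdj u) (Q.iQAdj u') := by
  rw [hQ, Q.inner_iQAdj, Q.iQ_iQAdj]

/-! ### The integrands -/

/-- The functional `Φ*(s)v*`, stopped at time `T`. -/
def adjIntegrand (T : ℝ≥0) (Φ : ℝ≥0 → Ω → U →L[ℝ] V) (v : StrongDual ℝ V) (s : ℝ≥0) (ω : Ω) :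
    StrongDual ℝ U :=
  v.comp (Φ (min s T) ω)

namespace MemM

variable {T : ℝ≥0} {Φ : ℝ≥0 → Ω → U →L[ℝ] V} (hΦ : MemM F P T Φ) (v : StrongDual ℝ V)
include hΦ

theorem measurable_adjIntegrand :
    Measurable fun p : ℝ≥0 × Ω => adjIntegrand T Φ v p.1 p.2 :=
  (hΦ.measurable v).comp (f := fun p : ℝ≥0 × Ω =>
    ((⟨min p.1 T, ⟨bot_le, min_le_right _ _⟩⟩, p.2) : Set.Icc 0 T × Ω)) (by fun_prop)

theorem measurable_adjIntegrand_apply (x : U) :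
    Measurable fun p : ℝ≥0 × Ω => adjIntegrand T Φ v p.1 p.2 x :=
  (ContinuousLinearMap.apply ℝ ℝ x).continuous.measurable.comp (hΦ.measurable_adjIntegrand v)

theorem aestronglyMeasurable_adjIntegrand_apply (x : U) (s : ℝ≥0) :
    AEStronglyMeasurable[F s] (fun ω => adjIntegrand T Φ v s ω x) P := by
  have h1 : Measurable[F (min s T)] fun ω => adjIntegrand T Φ v s ω :=
    hΦ.adapted v _ (min_le_right _ _)
  have h2 := (ContinuousLinearMap.apply ℝ ℝ x).continuous.measurable.comp h1
  exact ((h2.mono (F.mono (min_le_left _ _)) le_rfl).stronglyMeasurable).aestronglyMeasurable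

theorem lintegral_lintegral_iQAdj_lt_top [CompleteSpace U] (Q : PosSymmOperator U) {t : ℝ≥0}
    (ht : t ≤ T) :
    ∫⁻ s in Set.Icc 0 t, ∫⁻ ω, ‖Q.iQAdj (v.comp (Φ s ω))‖ₑ ^ 2 ∂P ∂lebesgueNN < ∞ := by
  have hle : ∀ x : StrongDual ℝ U, ‖Q.iQAdj x‖ₑ ^ 2 ≤ (‖Q.iQ‖ₑ ^ 2) * ‖x‖ₑ ^ 2 := by
    intro x
    rw [← mul_pow]
    gcongr
    rw [PosSymmOperator.iQAdj, ← ofReal_norm, LinearIsometryEquiv.norm_map, ← ofReal_norm,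
      ← ofReal_norm, ← ENNReal.ofReal_mul (norm_nonneg _), mul_comm]
    exact ENNReal.ofReal_le_ofReal (x.opNorm_comp_le Q.iQ)
  calc _ ≤ ∫⁻ s in Set.Icc 0 T, ∫⁻ ω, ‖Q.iQ‖ₑ ^ 2 * ‖v.comp (Φ s ω)‖ₑ ^ 2 ∂P ∂lebesgueNN :=
        (lintegral_mono_set (Set.Icc_subset_Icc_right ht)).trans
          (lintegral_mono fun s => lintegral_mono fun ω => hle _)
    _ = ‖Q.iQ‖ₑ ^ 2 * ∫⁻ s in Set.Icc 0 T, ∫⁻ ω, ‖v.comp (Φ s ω)‖ₑ ^ 2 ∂P ∂lebesgueNN := by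
        simp_rw [lintegral_const_mul' (‖Q.iQ‖ₑ ^ 2) _ (by simp)]
    _ < ∞ := ENNReal.mul_lt_top (by simp) (hΦ.sq_integrable v)

variable [IsProbabilityMeasure P]

theorem memLp_adjIntegrand_apply (x : U) {t : ℝ≥0} (ht : t ≤ T) :
    MemLp (fun p : ℝ≥0 × Ω => adjIntegrand T Φ v p.1 p.2 x) 2 (timeProd P t) := by
  have hle : timeProd P t ≤ timeProd P T :=
    Measure.prod_mono (Measure.restrict_mono (Set.Icc_subset_Icc_right ht) le_rfl) le_rfl
  refine MemLp.mono_measure hle ?_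
  have hm := (hΦ.measurable_adjIntegrand v).norm.aestronglyMeasurable (μ := timeProd P T)
  have hn : MemLp (fun p : ℝ≥0 × Ω => ‖adjIntegrand T Φ v p.1 p.2‖) 2 (timeProd P T) := by
    refine ⟨hm, ?_⟩
    have h1 := lintegral_lintegral_enorm_sq (h := fun s ω => ‖adjIntegrand T Φ v s ω‖) hm
    have h2 : ∫⁻ s in Set.Icc 0 T, ∫⁻ ω, ‖‖adjIntegrand T Φ v s ω‖‖ₑ ^ 2 ∂P ∂lebesgueNN < ∞ := by
      refine lt_of_eq_of_lt ?_ (hΦ.sq_integrable v)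
      refine setLIntegral_congr_fun measurableSet_Icc fun s hs => ?_
      simp only [adjIntegrand, min_eq_left hs.2, enorm_norm]
    rw [h1] at h2
    by_contra h3
    rw [not_lt, top_le_iff] at h3
    simp [h3] at h2
  refine MemLp.of_le_mul (c := ‖x‖) hn (hΦ.measurable_adjIntegrand_apply v x).aestronglyMeasurable
    (.of_forall fun p => ?_)
  rw [norm_norm, mul_comm]
  exact (adjIntegrand T Φ v p.1 p.2).le_opNorm x

/-- Parseval's identity for the integrands. -/
theorem tsum_lintegral_lintegral [CompleteSpace U] (Q : PosSymmOperator U) {ι : Type*} [Countable ι]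
    (e : HilbertBasis ι ℝ Q.RKHS) {t : ℝ≥0} (ht : t ≤ T) :
    ∑' k, ∫⁻ s in Set.Icc 0 t, ∫⁻ ω, ‖adjIntegrand T Φ v s ω (Q.iQ (e k))‖ₑ ^ 2 ∂P ∂lebesgueNN =
      ∫⁻ s in Set.Icc 0 t, ∫⁻ ω, ‖Q.iQAdj (v.comp (Φ s ω))‖ₑ ^ 2 ∂P ∂lebesgueNN := by
  have hm : ∀ k, Measurable fun p : ℝ≥0 × Ω => ‖adjIntegrand T Φ v p.1 p.2 (Q.iQ (e k))‖ₑ ^ 2 :=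
    fun k => (hΦ.measurable_adjIntegrand_apply v _).enorm.pow_const 2
  rw [← lintegral_tsum fun k => (hm k).lintegral_prod_right'.aemeasurable]
  refine setLIntegral_congr_fun measurableSet_Icc fun s hs => ?_
  simp only
  have hs' : ∀ k, AEMeasurable (fun ω => ‖adjIntegrand T Φ v s ω (Q.iQ (e k))‖ₑ ^ 2) P :=
    fun k => ((hm k).comp measurable_prodMk_left).aemeasurable
  rw [← lintegral_tsum hs']
  refine lintegral_congr fun ω => ?_
  -- After two uses of Tonelli the claim is pointwise: `⟨Φ i_Q e_k, v*⟩` is the `k`-th coordinate of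
  -- `i_Q*Φ*v*`.
  rw [← e.tsum_enorm_inner_sq]
  refine tsum_congr fun k => ?_
  rw [Q.inner_iQAdj, adjIntegrand, min_eq_left (hs.2.trans ht)]

end MemM

theorem lintegral_enorm_sq_eq (x : Lp ℝ 2 P) : ∫⁻ ω, ‖x ω‖ₑ ^ 2 ∂P = ‖x‖ₑ ^ 2 := by
  have := eLpNorm_nnreal_pow_eq_lintegral (p := 2) (by simp) (f := x) (μ := P)
  simp only [NNReal.coe_ofNat, ENNReal.rpow_ofNat, ENNReal.coe_ofNat] at this
  rw [Lp.enorm_def, this]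

/-! ### The terms of the series -/

section Series

variable [IsProbabilityMeasure P] [CompleteSpace U] {W : ℝ≥0 → CylRV U P}
  (hW : IsWeaklyCylWiener F P W) {Q : PosSymmOperator U} (hQ : HasCovarianceOperator P (W 1) Q.op)
  {ι : Type*} {e : HilbertBasis ι ℝ Q.RKHS} {u : ι → StrongDual ℝ U} (hu : ∀ k, Q.iQAdj (u k) = e k)
  {T : ℝ≥0} {Φ : ℝ≥0 → Ω → U →L[ℝ] V} (hΦ : MemM F P T Φ) (v : StrongDual ℝ V)
include hW hQ hu

theorem hasCovariation_one (k : ι) :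
    HasCovariation F P 1 (fun t ω => W t (u k) ω) (fun t ω => W t (u k) ω) := by
  have := hW.hasCovariation (u k) (u k)
  rwa [covariance_eq_inner hQ, hu, real_inner_self_eq_norm_sq, e.orthonormal.1 k, one_pow] at this

theorem hasCovariation_zero {j k : ι} (hjk : j ≠ k) :
    HasCovariation F P 0 (fun t ω => W t (u j) ω) (fun t ω => W t (u k) ω) := by
  have := hW.hasCovariation (u j) (u k)
  rwa [covariance_eq_inner hQ, hu, hu, e.orthonormal.2 hjk] at this

include hΦ

theorem isItoIntegral_cylIntegralTerm_stopped {t : ℝ≥0} (ht : t ≤ T) (k : ι) :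
    IsItoIntegral F P (fun s ω => W s (u k) ω) (fun s ω => adjIntegrand T Φ v s ω (Q.iQ (e k))) t
      (cylIntegralTerm F P W Q e u Φ t v k) := by
  have hcongr : ∀ s ≤ t, (fun ω => adjIntegrand T Φ v s ω (Q.iQ (e k))) =
      fun ω => v (Φ s ω (Q.iQ (e k))) := fun s hs => by
    simp only [adjIntegrand, min_eq_left (hs.trans ht), ContinuousLinearMap.comp_apply]
  obtain ⟨I, hI⟩ := exists_isItoIntegral (hW.hasOrthogonalIncrements (u k))
    (hasCovariation_one hW hQ hu k) (hΦ.aestronglyMeasurable_adjIntegrand_apply v (Q.iQ (e k)))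
    (hΦ.memLp_adjIntegrand_apply v (Q.iQ (e k)) ht)
  have hex : ∃ I, IsItoIntegral F P (fun s ω => W s (u k) ω)
      (fun s ω => v (Φ s ω (Q.iQ (e k)))) t I := ⟨I, hI.congr hcongr⟩
  rw [cylIntegralTerm, itoIntegral, dif_pos hex]
  exact hex.choose_spec.congr fun s hs => (hcongr s hs).symm

theorem isItoIntegral_cylIntegralTerm {t : ℝ≥0} (ht : t ≤ T) (k : ι) :
    IsItoIntegral F P (fun s ω => W s (u k) ω) (fun s ω => v (Φ s ω (Q.iQ (e k)))) t
      (cylIntegralTerm F P W Q e u Φ t v k) :=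
  (isItoIntegral_cylIntegralTerm_stopped hW hQ hu hΦ v ht k).congr fun s hs => by
    simp only [adjIntegrand, min_eq_left (hs.trans ht), ContinuousLinearMap.comp_apply]

/-- The two-integrator isometry with covariation rate 0. -/
theorem pairwise_inner_cylIntegralTerm {t : ℝ≥0} (ht : t ≤ T) :
    Pairwise fun j k => inner ℝ (cylIntegralTerm F P W Q e u Φ t v j)
      (cylIntegralTerm F P W Q e u Φ t v k) = 0 := by
  intro j k hjk
  have h := (isItoIntegral_cylIntegralTerm_stopped hW hQ hu hΦ v ht j).inner_eq
    (hW.hasOrthogonalIncrements (u j)) (hW.hasOrthogonalIncrements (u k))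
    (hasCovariation_zero hW hQ hu hjk) (hΦ.memLp_adjIntegrand_apply v _ ht)
    (hΦ.memLp_adjIntegrand_apply v _ ht) (isItoIntegral_cylIntegralTerm_stopped hW hQ hu hΦ v ht k)
  rwa [zero_mul] at h

/-- Itô's isometry for the terms of the series. -/
theorem enorm_cylIntegralTerm_sq {t : ℝ≥0} (ht : t ≤ T) (k : ι) :
    ‖cylIntegralTerm F P W Q e u Φ t v k‖ₑ ^ 2 =
      ∫⁻ s in Set.Icc 0 t, ∫⁻ ω, ‖adjIntegrand T Φ v s ω (Q.iQ (e k))‖ₑ ^ 2 ∂P ∂lebesgueNN := by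
  have hmem := hΦ.memLp_adjIntegrand_apply v (Q.iQ (e k)) ht
  have hI := isItoIntegral_cylIntegralTerm_stopped hW hQ hu hΦ v ht k
  have h := hI.inner_eq (hW.hasOrthogonalIncrements (u k)) (hW.hasOrthogonalIncrements (u k))
    (hasCovariation_one hW hQ hu k) hmem hmem hI
  rw [one_mul, real_inner_self_eq_norm_sq, real_inner_self_eq_norm_sq,
    sq_eq_sq₀ (norm_nonneg _) (norm_nonneg _)] at h
  rw [lintegral_lintegral_enorm_sq (h := fun s ω => adjIntegrand T Φ v s ω (Q.iQ (e k))) hmem.1,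
    ← ofReal_norm, h, ofReal_norm, Lp.enorm_toLp]

/-- Both sides are Itô integrals of the same integrand over `[0, t]`, and these are unique. -/
theorem condExpLp_cylIntegralTerm {t : ℝ≥0} (ht : t ≤ T) (k : ι) :
    condExpLp P (F.le t) (cylIntegralTerm F P W Q e u Φ T v k) =
      cylIntegralTerm F P W Q e u Φ t v k :=
  ((isItoIntegral_cylIntegralTerm_stopped hW hQ hu hΦ v le_rfl k).condExpLp
    (hW.hasOrthogonalIncrements (u k)) ht (hΦ.memLp_adjIntegrand_apply v _ le_rfl)).unique
    (hW.hasOrthogonalIncrements (u k)) (hasCovariation_one hW hQ hu k)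
    (hΦ.memLp_adjIntegrand_apply v _ ht) (isItoIntegral_cylIntegralTerm_stopped hW hQ hu hΦ v ht k)

variable [Countable ι]

theorem tsum_enorm_cylIntegralTerm_sq {t : ℝ≥0} (ht : t ≤ T) :
    ∑' k, ‖cylIntegralTerm F P W Q e u Φ t v k‖ₑ ^ 2 =
      ∫⁻ s in Set.Icc 0 t, ∫⁻ ω, ‖Q.iQAdj (v.comp (Φ s ω))‖ₑ ^ 2 ∂P ∂lebesgueNN := by
  rw [← hΦ.tsum_lintegral_lintegral v Q e ht]
  exact tsum_congr fun k => enorm_cylIntegralTerm_sq hW hQ hu hΦ v ht k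

/-- An orthogonal series converges once its squared norms are summable, and their sum is finite by
Parseval and boundedness of `i_Q*`. -/
theorem summable_cylIntegralTerm {t : ℝ≥0} (ht : t ≤ T) :
    Summable (cylIntegralTerm F P W Q e u Φ t v) := by
  refine summable_of_pairwise_inner_eq_zero
    (pairwise_inner_cylIntegralTerm hW hQ hu hΦ v ht) ?_
  have h := tsum_enorm_cylIntegralTerm_sq hW hQ hu hΦ v ht
  have h1 := ENNReal.summable_toReal
    (h.trans_lt (hΦ.lintegral_lintegral_iQAdj_lt_top v Q ht)).ne
  refine h1.congr fun k => ?_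
  rw [ENNReal.toReal_pow, toReal_enorm]

/-- Itô's isometry for the cylindrical integral. -/
theorem lintegral_enorm_cylIntegral_sq {t : ℝ≥0} (ht : t ≤ T) :
    ∫⁻ ω, ‖cylIntegral F P W Q e u Φ t v ω‖ₑ ^ 2 ∂P =
      ∫⁻ s in Set.Icc 0 t, ∫⁻ ω, ‖Q.iQAdj (v.comp (Φ s ω))‖ₑ ^ 2 ∂P ∂lebesgueNN := by
  rw [lintegral_enorm_sq_eq, ← tsum_enorm_cylIntegralTerm_sq hW hQ hu hΦ v ht]
  have h := hasSum_norm_sq_of_pairwise_inner_eq_zero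
    (pairwise_inner_cylIntegralTerm hW hQ hu hΦ v ht) (summable_cylIntegralTerm hW hQ hu hΦ v ht)
  have h1 : ∀ x : Lp ℝ 2 P, ‖x‖ₑ ^ 2 = ENNReal.ofReal (‖x‖ ^ 2) := fun x => by
    rw [ENNReal.ofReal_pow (norm_nonneg _), ofReal_norm]
  simp_rw [h1]
  rw [← ENNReal.ofReal_tsum_of_nonneg (fun k => sq_nonneg _) h.summable, h.tsum_eq]
  rfl

theorem condExpLp_cylIntegral {t : ℝ≥0} (ht : t ≤ T) :
    condExpLp P (F.le t) (cylIntegral F P W Q e u Φ T v) = cylIntegral F P W Q e u Φ t v := by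
  rw [cylIntegral, (condExpLp P (F.le t)).map_tsum (summable_cylIntegralTerm hW hQ hu hΦ v le_rfl)]
  exact tsum_congr fun k => condExpLp_cylIntegralTerm hW hQ hu hΦ v ht k

theorem cylIntegral_mem_continuousVersionSet :
    cylIntegral F P W Q e u Φ T v ∈ continuousVersionSet F P T := by
  refine tsum_mem_continuousVersionSet (fun k => ?_)
    (summable_cylIntegralTerm hW hQ hu hΦ v le_rfl)
  obtain ⟨X, hXc, hX⟩ := hW.exists_continuous_modification (u k)
  exact (isItoIntegral_cylIntegralTerm_stopped hW hQ hu hΦ v le_rfl k).mem_continuousVersionSet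
    (hW.hasOrthogonalIncrements (u k)) hXc hX (hΦ.memLp_adjIntegrand_apply v _ le_rfl)

end Series

end Main

end

theorem mainTheorem4
    {U : Type*} [NormedAddCommGroup U] [NormedSpace ℝ U] [CompleteSpace U]
    [TopologicalSpace.SeparableSpace U]
    {V : Type*} [NormedAddCommGroup V] [NormedSpace ℝ V] [CompleteSpace V]
    [TopologicalSpace.SeparableSpace V]
    {Ω : Type*} {mΩ : MeasurableSpace Ω} (P : Measure Ω) [IsProbabilityMeasure P]
    (F : Filtration ℝ≥0 mΩ)
    (W : ℝ≥0 → CylRV U P) (hW : IsStronglyCylWiener F P W)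
    (Q : PosSymmOperator U) (hQ : HasCovarianceOperator P (W 1) Q.op)
    {ι : Type*} [Countable ι] (e : HilbertBasis ι ℝ Q.RKHS)
    (u : ι → StrongDual ℝ U) (hu : ∀ k, Q.iQAdj (u k) = e k)
    (T : ℝ≥0) (Φ : ℝ≥0 → Ω → U →L[ℝ] V) (hΦ : MemM F P T Φ)
    (v : StrongDual ℝ V) :
    -- the Itô integrals and the series that define the cylindrical integral exist
    (∀ t ≤ T,
      (∀ k, IsItoIntegral F P (fun s ω => W s (u k) ω) (fun s ω => v (Φ s ω (Q.iQ (e k)))) t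
        (cylIntegralTerm F P W Q e u Φ t v k)) ∧
      Summable (cylIntegralTerm F P W Q e u Φ t v)) ∧
    -- (a) continuous square-integrable martingale, up to the choice of a version
    (∃ M : Set.Icc 0 T → Ω → ℝ, IsContSqMartingale F P T M ∧
      ∀ t : Set.Icc 0 T, M t =ᵐ[P] cylIntegral F P W Q e u Φ t v) ∧
    -- (b) the isometry
    (∀ t ≤ T, ∫⁻ ω, ‖cylIntegral F P W Q e u Φ t v ω‖ₑ ^ 2 ∂P =
      ∫⁻ s in Set.Icc 0 t, ∫⁻ ω, ‖Q.iQAdj (v.comp (Φ s ω))‖ₑ ^ 2 ∂P ∂lebesgueNN) := by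
  have hw := hW.weakly
  refine ⟨fun t ht => ⟨fun k => isItoIntegral_cylIntegralTerm hw hQ hu hΦ v ht k,
    summable_cylIntegralTerm hw hQ hu hΦ v ht⟩, ?_,
    fun t ht => lintegral_enorm_cylIntegral_sq hw hQ hu hΦ v ht⟩
  obtain ⟨X, hX⟩ := cylIntegral_mem_continuousVersionSet hw hQ hu hΦ v
  obtain ⟨M, hM, hMX⟩ := hX.exists_isContSqMartingale
  refine ⟨M, hM, fun t => ?_⟩
  -- The integral up to `t` is the conditional expectation of the integral up to `T`, so the
  -- continuous version built from the terminal value serves all times.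
  rw [← condExpLp_cylIntegral hw hQ hu hΦ v t.2.2]
  exact hMX t
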